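/- All graphs are finite, simple and undirected. A set $S$ of vertices of $G=(V,E)$ is $k$-dependent if every vertex of the induced subgraph $G[S]$ has degree at most $k$; a maximum $k$-dependent set is one of maximum cardinality. Consider the following algorithm with input a graph $G$ and an integer $k\ge 1$: put $G_0=G$; for $i=1,\dots,k$ choose any maximum-cardinality matching $M_i$ of $G_{i-1}$ and let $G_i$ be $G_{i-1}$ with the edges of $M_i$ deleted (all vertices are kept); output any maximum independent set $S$ of $G_k$. **Theorem.** (a) If $G$ is bipartite and $k\ge1$, then every possible output $S$ of the algorithm is a $k$-dependent set of $G$, and every maximum $k$-dependent set $I^*_k$ of $G$ satisfies $$|I^*_k|\le\Bigl(1+\frac{k}{k+2}\Bigr)|S| .$$ (b) The algorithm can be implemented to run in $O(km\sqrt n+n+1)$ time on bipartite graphs with $n$ vertices and $m$ edges; in particular in $O(km\sqrt n)$ time if $n\geq 1$ and $G$ has no isolated vertices. More precisely, there are one program $P$ for a unit-cost random access machine (registers and arrays of natural numbers, whose only arithmetic operations are successor and predecessor) and a constant $C$ such that for every bipartite graph $G$ with vertex set $\{0,\dots,n-1\}$ and $m$ edges, given as a list of its edges in any order without a bipartition,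 and every $k\ge 1$ (also part of the input), $P$ halts after at most $C(km\sqrt n+n+1)$ steps and returns a possible output $S$ of the algorithm on $G$ and $k$. (c) The conclusion of (a) holds for every execution of the algorithm with $k\ge1$ on an arbitrary finite graph $G$ in which each of $G_0,\dots,G_{k-1}$ is a König–Egerváry graph (a graph whose maximum matching size equals its minimum vertex cover size). In particular it holds for $k=1$ on every König–Egerváry graph. -/

import Mathlib

/-! ## Matchings, `k`-dependent sets, König–Egerváry graphs -/

namespace KDep

variable {V : Type*}

/-- `M` is a maximum-cardinality matching of `G` (`V` is finite in all uses). -/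
def IsMaximumMatching {G : SimpleGraph V} (M : G.Subgraph) : Prop :=
  M.IsMatching ∧ ∀ M' : G.Subgraph, M'.IsMatching → M'.edgeSet.ncard ≤ M.edgeSet.ncard

/-- `S` is a `k`-dependent set: every vertex of the induced subgraph `G[S]` has degree at most `k`
(`V` is finite in all uses). -/
def IsKDependent (G : SimpleGraph V) (k : ℕ) (S : Finset V) : Prop :=
  ∀ v : (S : Set V), ((G.induce (S : Set V)).neighborSet v).ncard ≤ k

/-- `I` is a maximum `k`-dependent set of `G`. -/
def IsMaximumKDependent (G : SimpleGraph V) (k : ℕ) (I : Finset V) : Prop :=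
  IsKDependent G k I ∧ ∀ T : Finset V, IsKDependent G k T → T.card ≤ I.card

/-- The maximum size of a matching equals the minimum size of a vertex cover. -/
def IsKonigEgervary (G : SimpleGraph V) : Prop :=
  ∃ M : G.Subgraph, IsMaximumMatching M ∧ M.edgeSet.encard = G.vertexCoverNum

/-! ## The approximation algorithm, as a nondeterministic procedure

Any maximum matching may be chosen in each round and any maximum independent set at the end. -/

/-- `H 0 = G, H 1, …, H k` are the successive residual graphs of a possible execution of the first
stage: each arises from the previous one by deleting the edges of a maximum matching of it. -/
def IsResidualSequence (G : SimpleGraph V) (k : ℕ) (H : ℕ → SimpleGraph V) : Prop :=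
  H 0 = G ∧ ∀ i < k, ∃ M : (H i).Subgraph,
    IsMaximumMatching M ∧ H (i + 1) = (H i).deleteEdges M.edgeSet

/-- `S` is a possible output of the algorithm on `G` and `k`. -/
def IsAlgorithmOutput [Finite V] (G : SimpleGraph V) (k : ℕ) (S : Finset V) : Prop :=
  ∃ H : ℕ → SimpleGraph V, IsResidualSequence G k H ∧ (H k).IsMaximumIndepSet S

end KDep

/-! ## A random access machine with a step count

Programs use finitely many registers and arrays (those they name) over the natural numbers.  The
only arithmetic is successor and predecessor, so within `t` steps no value exceeds the largest
input value and literal by more than `t`, and unit cost per operation is justified. -/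

namespace RAM

structure State where
  reg : ℕ → ℕ
  arr : ℕ → ℕ → ℕ

inductive Expr where
  | lit (c : ℕ)
  | var (x : ℕ)
  | get (a : ℕ) (i : Expr)
  | succ (e : Expr)
  | pred (e : Expr)

namespace Expr

def eval (σ : State) : Expr → ℕ
  | lit c => c
  | var x => σ.reg x
  | get a i => σ.arr a (i.eval σ)
  | succ e => e.eval σ + 1
  | pred e => e.eval σ - 1

/-- One step for every node of the expression. -/
def cost : Expr → ℕ
  | lit _ => 1
  | var _ => 1
  | get _ i => i.cost + 1
  | succ e => e.cost + 1
  | pred e => e.cost + 1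

end Expr

inductive Test where
  | eq (e f : Expr)
  | lt (e f : Expr)

namespace Test

def Holds (σ : State) : Test → Prop
  | eq e f => e.eval σ = f.eval σ
  | lt e f => e.eval σ < f.eval σ

def cost : Test → ℕ
  | eq e f => e.cost + f.cost + 1
  | lt e f => e.cost + f.cost + 1

end Test

inductive Program where
  | skip
  | assign (x : ℕ) (e : Expr)
  | store (a : ℕ) (i e : Expr)
  | seq (p q : Program)
  | ite (b : Test) (p q : Program)
  | loop (b : Test) (p : Program)

/-- `Exec p σ τ t`: started in state `σ`, the program `p` halts in state `τ` after `t` steps.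
`loop b p` repeats `p` as long as `b` holds. -/
inductive Exec : Program → State → State → ℕ → Prop
  | skip (σ : State) : Exec .skip σ σ 1
  | assign (x : ℕ) (e : Expr) (σ : State) :
      Exec (.assign x e) σ { σ with reg := Function.update σ.reg x (e.eval σ) } (e.cost + 1)
  | store (a : ℕ) (i e : Expr) (σ : State) :
      Exec (.store a i e) σ
        { σ with arr := Function.update σ.arr a
                          (Function.update (σ.arr a) (i.eval σ) (e.eval σ)) }
        (i.cost + e.cost + 1)
  | seq {p q : Program} {σ τ υ : State} {s t : ℕ} :
      Exec p σ τ s → Exec q τ υ t → Exec (.seq p q) σ υ (s + t)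
  | ite_true {b : Test} {p q : Program} {σ τ : State} {t : ℕ} :
      b.Holds σ → Exec p σ τ t → Exec (.ite b p q) σ τ (b.cost + t)
  | ite_false {b : Test} {p q : Program} {σ τ : State} {t : ℕ} :
      ¬ b.Holds σ → Exec q σ τ t → Exec (.ite b p q) σ τ (b.cost + t)
  | loop_true {b : Test} {p : Program} {σ τ υ : State} {s t : ℕ} :
      b.Holds σ → Exec p σ τ s → Exec (.loop b p) τ υ t →
      Exec (.loop b p) σ υ (b.cost + s + t)
  | loop_false {b : Test} {p : Program} {σ : State} :
      ¬ b.Holds σ → Exec (.loop b p) σ σ b.cost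

/-- `es` lists every edge of `G` exactly once, in any order and orientation. -/
def IsEdgeList {n : ℕ} (G : SimpleGraph (Fin n)) (es : List (Fin n × Fin n)) : Prop :=
  (es.map fun e => s(e.1, e.2)).Nodup ∧
    ∀ e : Sym2 (Fin n), e ∈ (es.map fun e => s(e.1, e.2)) ↔ e ∈ G.edgeSet

/-- The initial state: registers `0`, `1`, `2` hold the number `n` of vertices, the number of edges
and `k`; arrays `0` and `1` hold the two ends of the listed edges; everything else is zero. -/
def inputState (n k : ℕ) (es : List (Fin n × Fin n)) : State where
  reg := fun x => if x = 0 then n else if x = 1 then es.length else if x = 2 then k else 0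
  arr := fun a i =>
    if a = 0 then (es.map fun e => (e.1 : ℕ)).getD i 0
    else if a = 1 then (es.map fun e => (e.2 : ℕ)).getD i 0
    else 0

/-- The vertex set that a final state describes: the vertices marked by `1` in array `2`. -/
def outputSet (n : ℕ) (τ : State) : Finset (Fin n) :=
  Finset.univ.filter fun v => τ.arr 2 (v : ℕ) = 1

end RAM

/-!
**Ratio.** Let `S` be a maximum independent set of the last residual graph `H k`, and `I` a
`k`-dependent set of `G`.  If `H i` is a König–Egerváry graph, then its maximum matchings have
`n - α(H i) ≥ n - |S|` edges.  At most `n - |I|` edges of a matching meet the complement of `I`, so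
that each of the `k` rounds deletes at least `|I| - |S|` edges inside `I`
(`KDep.ncard_edgeSet_restrictTo_deleteEdges`).  Since `G[I]` has at most `k |I| / 2` edges, at most
`k |I| / 2 - k (|I| - |S|)` of them remain in `H k`; deleting one end of each leaves an independent
set, whence `|S| ≥ |I| - k |I| / 2 + k (|I| - |S|)`, that is `(k + 2) |I| ≤ (2 k + 2) |S|`
(`KDep.IsResidualSequence.card_mul_le`).  Feasibility holds because each round removes at most one
edge at every vertex.  For bipartite graphs, Kőnig's theorem follows from Hall's theorem, applied to
a minimum vertex cover `C` and the neighbours of its vertices outside `C`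
(`KDep.isKonigEgervary_of_isBipartite`).

**Running time.** The program stores both directions of each edge as arcs in linked lists, colours
the vertices by breadth-first search, and keeps alive only the arcs that leave colour class `2`.
Each matching is then computed in `O(m √n)` steps, in two stages with a level bound `L ≈ √(2 n)`.

* An auction: a free left vertex bids for a right neighbour whose price equals its own level,
  raising the price by one and displacing the previous partner; if it has scanned its whole list
  without success, its level rises.  Each vertex scans its list at most `L + 1` times.  When all
  free left vertices have reached level `L + 1`, levels and prices form a nearly optimal fractional
  vertex cover, and weak duality shows that the matching `M` satisfies `(L + 1) ν ≤ (L + 2) |M|`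
  (`RAM.ArcList.Auction.card_le`), so that it is short of the optimum by at most `L` edges.
* At most `L` augmentations along alternating paths found by breadth-first search, each in `O(m)`
  steps.  The final, unsuccessful search yields a vertex cover as large as the matching
  (`RAM.card_searchCover_le`), which proves that the matching is maximum.

After `k` rounds one more matching is computed, and the complement of the cover found is a maximum
independent set.

Programs are verified with a weakest precondition calculus for total correctness.  Its loop rule
(`RAM.WP_loop`) carries a credit in the invariant, which makes amortized time bounds part of the
invariant.
-/

/-! ### Matchings, covers and the approximation ratio -/

namespace KDep

variable {V : Type*}

/-- Two edges of a matching with a common vertex coincide. -/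
theorem edge_eq_of_mem_of_isMatching {G : SimpleGraph V} {M : G.Subgraph} (hM : M.IsMatching)
    {e e' : Sym2 V} (he : e ∈ M.edgeSet) (he' : e' ∈ M.edgeSet) {v : V} (hv : v ∈ e)
    (hv' : v ∈ e') : e = e' := by
  obtain ⟨w, rfl⟩ := hv
  obtain ⟨w', rfl⟩ := hv'
  rw [SimpleGraph.Subgraph.mem_edgeSet] at he he'
  rw [hM.eq_of_adj_left he he']

/-- If every edge of a set `E` of matching edges meets `C`, then `E` has at most `|C|` edges. -/
theorem ncard_le_card_of_forall_meets {G : SimpleGraph V} {M : G.Subgraph} (hM : M.IsMatching)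
    {E : Set (Sym2 V)} (hE : E ⊆ M.edgeSet) {C : Finset V} (hC : ∀ e ∈ E, ∃ v ∈ C, v ∈ e) :
    E.ncard ≤ C.card := by
  rcases E.eq_empty_or_nonempty with rfl | ⟨e₀, he₀⟩
  · simp
  have : Nonempty V := ⟨(hC e₀ he₀).choose⟩
  choose! f hf hfe using hC
  rw [← Set.ncard_coe_finset]
  refine Set.ncard_le_ncard_of_injOn f hf (fun e he e' he' h => ?_) C.finite_toSet
  exact edge_eq_of_mem_of_isMatching hM (hE he) (hE he') (hfe e he) (h ▸ hfe e' he')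

/-- Weak duality between matchings and vertex covers. -/
theorem ncard_edgeSet_le_card_of_isVertexCover {G : SimpleGraph V} {M : G.Subgraph}
    (hM : M.IsMatching) {C : Finset V} (hC : G.IsVertexCover C) : M.edgeSet.ncard ≤ C.card := by
  refine ncard_le_card_of_forall_meets hM subset_rfl fun e he => ?_
  induction e with
  | h x y =>
    rcases hC (M.adj_sub he) with h | h
    · exact ⟨x, h, by simp⟩
    · exact ⟨y, h, by simp⟩

theorem isMaximumMatching_of_isVertexCover {G : SimpleGraph V} {M : G.Subgraph}
    (hM : M.IsMatching) {C : Finset V} (hC : G.IsVertexCover C)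
    (h : C.card ≤ M.edgeSet.ncard) : IsMaximumMatching M :=
  ⟨hM, fun _ hM' => (ncard_edgeSet_le_card_of_isVertexCover hM' hC).trans h⟩

theorem isMaximumIndepSet_compl_of_isVertexCover [Fintype V] [DecidableEq V] {G : SimpleGraph V}
    {M : G.Subgraph} (hM : M.IsMatching) {C : Finset V} (hC : G.IsVertexCover C)
    (h : C.card ≤ M.edgeSet.ncard) : G.IsMaximumIndepSet Cᶜ := by
  refine ⟨by simpa using hC, fun T hT => ?_⟩
  have hT' : G.IsVertexCover (Tᶜ : Finset V) := by
    rw [Finset.coe_compl, SimpleGraph.isVertexCover_compl]; exact hT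
  have := ncard_edgeSet_le_card_of_isVertexCover hM hT'
  have h1 := Finset.card_add_card_compl T
  have h2 := Finset.card_add_card_compl C
  omega

/-- A family of pairwise disjoint edges of `G` is the edge set of a matching. -/
theorem exists_isMatching_of_disjoint_edges {ι : Type*} {G : SimpleGraph V} {a b : ι → V}
    (hab : ∀ i, G.Adj (a i) (b i)) (ha : Function.Injective a) (hb : Function.Injective b)
    (hne : ∀ i j, a i ≠ b j) :
    ∃ M : G.Subgraph, M.IsMatching ∧ M.edgeSet = Set.range fun i => s(a i, b i) := by
  refine ⟨⨆ i, G.subgraphOfAdj (hab i), SimpleGraph.Subgraph.IsMatching.iSup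
    (fun i => SimpleGraph.Subgraph.IsMatching.subgraphOfAdj _) fun i j hij => ?_, ?_⟩
  · simp only [SimpleGraph.support_subgraphOfAdj]
    rw [Set.disjoint_left]
    rintro x (rfl | rfl) (h | h)
    · exact hij (ha h)
    · exact hne _ _ h
    · exact hne _ _ h.symm
    · exact hij (hb h)
  · ext e
    simp [SimpleGraph.Subgraph.edgeSet_iSup, eq_comm]

theorem injective_edges {ι : Type*} {a b : ι → V} (ha : Function.Injective a)
    (hne : ∀ i j, a i ≠ b j) : Function.Injective fun i => s(a i, b i) := by
  intro i j h
  rcases Sym2.eq_iff.1 h with h | h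
  · exact ha h.1
  · exact absurd h.1 (hne _ _)

/-- In a graph properly coloured by `c`, the part of a minimum vertex cover `C` in one colour class
satisfies Hall's condition towards the vertices outside `C`: exchanging a subset for its
neighbours outside `C` gives another cover. -/
theorem card_le_card_neighbors_of_minimum_cover [Fintype V] [DecidableEq V] {G : SimpleGraph V}
    [DecidableRel G.Adj] (c : G.Coloring (Fin 2)) {C : Finset V} (hC : G.IsVertexCover C)
    (hmin : ∀ D : Finset V, G.IsVertexCover D → C.card ≤ D.card) {S : Finset V} (hSC : S ⊆ C)
    {i : Fin 2} (hS : ∀ v ∈ S, c v = i) :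
    S.card ≤ (S.biUnion fun v => G.neighborFinset v \ C).card := by
  have h := hmin ((C \ S) ∪ S.biUnion fun v => G.neighborFinset v \ C) ?_
  · have h1 := Finset.card_union_le (C \ S) (S.biUnion fun v => G.neighborFinset v \ C)
    have h2 := Finset.card_sdiff_add_card_eq_card hSC
    omega
  · have key : ∀ x y, G.Adj x y → x ∈ C →
        x ∈ ((C \ S) ∪ S.biUnion fun v => G.neighborFinset v \ C) ∨
        y ∈ ((C \ S) ∪ S.biUnion fun v => G.neighborFinset v \ C) := by
      intro x y hxy hx
      by_cases hxS : x ∈ S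
      · right
        have hyS : y ∉ S := fun hyS => c.valid hxy ((hS x hxS).trans (hS y hyS).symm)
        by_cases hy : y ∈ C
        · simp [hy, hyS]
        · simp only [Finset.mem_union, Finset.mem_biUnion, Finset.mem_sdiff,
            SimpleGraph.mem_neighborFinset]
          exact Or.inr ⟨x, hxS, hxy, hy⟩
      · left; simp [hx, hxS]
    intro x y hxy
    rw [Finset.mem_coe, Finset.mem_coe]
    rcases hC hxy with h | h
    · exact key x y hxy h
    · exact (key y x hxy.symm h).symm

/-- **Kőnig's theorem**: bipartite graphs are König–Egerváry graphs. -/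
theorem isKonigEgervary_of_isBipartite [Finite V] {G : SimpleGraph V} (hG : G.IsBipartite) :
    IsKonigEgervary G := by
  classical
  cases nonempty_fintype V
  obtain ⟨c⟩ := hG
  obtain ⟨C₀, hC₀, hC⟩ := SimpleGraph.vertexCoverNum_exists G
  obtain ⟨C, rfl⟩ : ∃ C : Finset V, (C : Set V) = C₀ := ⟨C₀.toFinset, by simp⟩
  rw [Set.encard_coe_eq_coe_finsetCard] at hC₀
  have hmin : ∀ D : Finset V, G.IsVertexCover D → C.card ≤ D.card := fun D hD => by
    have := hD.vertexCoverNum_le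
    rw [← hC₀, Set.encard_coe_eq_coe_finsetCard] at this
    exact_mod_cast this
  -- Hall's condition for all of `C` follows by splitting into the two colour classes.
  obtain ⟨f, hf, hfC⟩ := (Finset.all_card_le_biUnion_card_iff_exists_injective
      (fun x : C => G.neighborFinset (x : V) \ C)).1 fun s => by
    set S := s.image Subtype.val with hSdef
    have hSC : S ⊆ C := by
      intro x hx; simp only [hSdef, Finset.mem_image] at hx; obtain ⟨y, -, rfl⟩ := hx; exact y.2
    have hcard : s.card = S.card :=
      (Finset.card_image_of_injective _ Subtype.val_injective).symm
    have hun : (s.biUnion fun x : C => G.neighborFinset (x : V) \ C)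
        = S.biUnion fun v => G.neighborFinset v \ C := by
      rw [hSdef, Finset.image_biUnion]
    rw [hcard, hun]
    have h0 := card_le_card_neighbors_of_minimum_cover c hC hmin (S := S.filter (c · = 0)) (i := 0)
      ((Finset.filter_subset _ _).trans hSC) (by simp)
    have h1 := card_le_card_neighbors_of_minimum_cover c hC hmin (S := S.filter (c · ≠ 0)) (i := 1)
      ((Finset.filter_subset _ _).trans hSC) (by
        intro v hv; have := (Finset.mem_filter.1 hv).2; omega)
    rw [← Finset.card_filter_add_card_filter_not (s := S) (c · = 0)]
    refine (add_le_add h0 h1).trans ?_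
    rw [← Finset.card_union_of_disjoint]
    · refine Finset.card_le_card (Finset.union_subset ?_ ?_) <;>
        exact Finset.biUnion_subset_biUnion_of_subset_left _ (Finset.filter_subset _ _)
    · rw [Finset.disjoint_left]
      intro x hx hx'
      simp only [Finset.mem_biUnion, Finset.mem_filter, Finset.mem_sdiff,
        SimpleGraph.mem_neighborFinset] at hx hx'
      obtain ⟨y, ⟨-, hy⟩, hyx, -⟩ := hx
      obtain ⟨z, ⟨-, hz⟩, hzx, -⟩ := hx'
      have := c.valid hyx
      have := c.valid hzx
      omega
  have hadj : ∀ x : C, G.Adj x (f x) := fun x => by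
    have := hfC x; simp at this; exact this.1
  have hne : ∀ x y : C, (x : V) ≠ f y := fun x y h => by
    have := hfC y; simp at this; exact this.2 (h ▸ x.2)
  obtain ⟨M, hM, hMe⟩ := exists_isMatching_of_disjoint_edges hadj Subtype.val_injective hf hne
  have hcard : M.edgeSet.ncard = C.card := by
    rw [hMe, Set.ncard_range_of_injective (injective_edges Subtype.val_injective hne)]; simp
  refine ⟨M, isMaximumMatching_of_isVertexCover hM hC hcard.ge, ?_⟩
  rw [← hC₀, ← hcard, Set.Finite.cast_ncard_eq (Set.toFinite _)]

theorem IsResidualSequence.succ_le {G : SimpleGraph V} {k : ℕ} {H : ℕ → SimpleGraph V}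
    (hH : IsResidualSequence G k H) {i : ℕ} (hi : i < k) : H (i + 1) ≤ H i := by
  obtain ⟨M, -, h⟩ := hH.2 i hi
  rw [h]; exact SimpleGraph.deleteEdges_le _

theorem IsResidualSequence.anti {G : SimpleGraph V} {k : ℕ} {H : ℕ → SimpleGraph V}
    (hH : IsResidualSequence G k H) {i j : ℕ} (hij : i ≤ j) (hj : j ≤ k) : H j ≤ H i := by
  induction j, hij using Nat.le_induction with
  | base => exact le_rfl
  | succ j hij ih => exact (hH.succ_le hj).trans (ih (by omega))

/-- A further round of the algorithm. -/
theorem IsResidualSequence.extend {V : Type*} {G : SimpleGraph V} {k : ℕ} {H : ℕ → SimpleGraph V}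
    (hH : IsResidualSequence G k H) {M : (H k).Subgraph} (hM : IsMaximumMatching M) :
    IsResidualSequence G (k + 1)
      (Function.update H (k + 1) ((H k).deleteEdges M.edgeSet)) := by
  refine ⟨by rw [Function.update_of_ne (by omega)]; exact hH.1, fun i hi => ?_⟩
  rw [Function.update_of_ne (show i ≠ k + 1 by omega)]
  rcases Nat.lt_succ_iff_lt_or_eq.1 hi with hi | rfl
  · rw [Function.update_of_ne (by omega)]
    exact hH.2 i hi
  · exact ⟨M, hM, by rw [Function.update_self]⟩

/-- At most `i` edges at each vertex are deleted in the first `i` rounds. -/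
theorem IsResidualSequence.ncard_deleted_le [Finite V] {G : SimpleGraph V} {k : ℕ}
    {H : ℕ → SimpleGraph V} (hH : IsResidualSequence G k H) (v : V) {i : ℕ} (hi : i ≤ k) :
    {w | G.Adj v w ∧ ¬ (H i).Adj v w}.ncard ≤ i := by
  induction i with
  | zero => simp [hH.1]
  | succ i ih =>
    obtain ⟨M, hM, h⟩ := hH.2 i hi
    have hsub : {w | G.Adj v w ∧ ¬ (H (i + 1)).Adj v w} ⊆
        {w | G.Adj v w ∧ ¬ (H i).Adj v w} ∪ {w | M.Adj v w} := by
      rintro w ⟨hw, hw'⟩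
      rw [h, SimpleGraph.deleteEdges_adj] at hw'
      by_cases hi : (H i).Adj v w
      · right; by_contra hn; exact hw' ⟨hi, fun he => hn he⟩
      · exact Or.inl ⟨hw, hi⟩
    have h1 : {w | M.Adj v w}.ncard ≤ 1 := by
      rw [Set.ncard_le_one (Set.toFinite _)]
      exact fun a ha b hb => hM.1.eq_of_adj_left ha hb
    have := Set.ncard_le_ncard hsub (Set.toFinite _)
    have := Set.ncard_union_le {w | G.Adj v w ∧ ¬ (H i).Adj v w} {w | M.Adj v w}
    have := ih (by omega)
    omega

theorem IsResidualSequence.isKDependent [Finite V] {G : SimpleGraph V} {k : ℕ}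
    {H : ℕ → SimpleGraph V} (hH : IsResidualSequence G k H) {S : Finset V}
    (hS : (H k).IsIndepSet S) : IsKDependent G k S := by
  intro v
  refine le_trans ?_ (hH.ncard_deleted_le (v : V) le_rfl)
  refine Set.ncard_le_ncard_of_injOn Subtype.val (fun w hw => ⟨hw, fun hk => ?_⟩)
    Subtype.val_injective.injOn (Set.toFinite _)
  exact hS v.2 w.2 hk.ne hk

/-- Deleting one end of each edge leaves an independent set. -/
theorem exists_isIndepSet_card_add_ncard_edgeSet [Finite V] (J : SimpleGraph V) (I : Finset V) :
    ∃ T ⊆ I, J.IsIndepSet T ∧ I.card ≤ T.card + J.edgeSet.ncard := by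
  classical
  refine ⟨I \ ((Set.toFinite J.edgeSet).toFinset.image fun e => e.out.1), Finset.sdiff_subset,
    fun x hx y hy _ hxy => ?_, ?_⟩
  · simp only [Finset.coe_sdiff, Finset.coe_image, Set.Finite.coe_toFinset, Set.mem_sdiff,
      Set.mem_image, not_exists, not_and] at hx hy
    have h : (s(x, y)).out.1 ∈ s(x, y) := Sym2.out_fst_mem _
    rcases Sym2.mem_iff.1 h with h | h
    · exact hx.2 _ hxy h
    · exact hy.2 _ hxy h
  · have h1 := Finset.le_card_sdiff
      ((Set.toFinite J.edgeSet).toFinset.image fun e => e.out.1) I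
    have h2 : ((Set.toFinite J.edgeSet).toFinset.image fun e => e.out.1).card
        ≤ J.edgeSet.ncard := by
      rw [Set.ncard_eq_toFinset_card _ (Set.toFinite _)]
      exact Finset.card_image_le
    omega

/-- The edges of `G` inside `I`, on the whole vertex set. -/
def restrictTo (G : SimpleGraph V) (I : Finset V) : SimpleGraph V where
  Adj x y := G.Adj x y ∧ x ∈ I ∧ y ∈ I
  symm := ⟨fun _ _ h => ⟨h.1.symm, h.2.2, h.2.1⟩⟩
  loopless := ⟨fun _ h => h.1.ne rfl⟩

theorem IsKDependent.two_mul_ncard_edgeSet_restrictTo_le [Finite V] {G : SimpleGraph V} {k : ℕ}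
    {I : Finset V} (hI : IsKDependent G k I) :
    2 * (restrictTo G I).edgeSet.ncard ≤ k * I.card := by
  classical
  cases nonempty_fintype V
  have h := (restrictTo G I).sum_degrees_eq_twice_card_edges
  rw [Set.ncard_eq_toFinset_card', ← SimpleGraph.edgeFinset, ← h,
    ← Finset.sum_subset (Finset.subset_univ I)]
  · rw [mul_comm, ← smul_eq_mul]
    refine Finset.sum_le_card_nsmul _ _ _ fun v hv => ?_
    refine le_trans ?_ (hI ⟨v, hv⟩)
    rw [← SimpleGraph.card_neighborFinset_eq_degree, ← Set.ncard_coe_finset,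
      SimpleGraph.coe_neighborFinset]
    rw [← Set.ncard_image_of_injective _ Subtype.val_injective]
    refine Set.ncard_le_ncard (fun w hw => ?_) (Set.toFinite _)
    exact ⟨⟨w, hw.2.2⟩, hw.1, rfl⟩
  · intro v _ hv
    rw [← SimpleGraph.card_neighborFinset_eq_degree, Finset.card_eq_zero,
      Finset.eq_empty_iff_forall_notMem]
    intro w hw
    rw [SimpleGraph.mem_neighborFinset] at hw
    exact hv hw.2.1

/-- In a König–Egerváry graph, the vertices left uncovered by a minimum vertex cover form an
independent set, so that every maximum matching has at least `n - α` edges. -/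
theorem IsKonigEgervary.card_le [Fintype V] {G : SimpleGraph V} (hG : IsKonigEgervary G)
    {M : G.Subgraph} (hM : IsMaximumMatching M) {s : ℕ}
    (hs : ∀ T : Finset V, G.IsIndepSet T → T.card ≤ s) :
    Fintype.card V ≤ M.edgeSet.ncard + s := by
  classical
  obtain ⟨N, hN, hNe⟩ := hG
  obtain ⟨C₀, hC₀, hC⟩ := SimpleGraph.vertexCoverNum_exists G
  obtain ⟨C, rfl⟩ : ∃ C : Finset V, (C : Set V) = C₀ := ⟨C₀.toFinset, by simp⟩
  rw [← hC₀, Set.encard_coe_eq_coe_finsetCard, ← Set.Finite.cast_ncard_eq (Set.toFinite _)] at hNe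
  have h1 : N.edgeSet.ncard = C.card := by exact_mod_cast hNe
  have h2 := hM.2 N hN.1
  have h3 := hs Cᶜ (by simpa using hC)
  have h4 := Finset.card_add_card_compl C
  omega

/-- Each round deletes at least `|M| - |V \ I|` of the edges inside `I`, since at most
`|V \ I|` edges of a matching leave `I`. -/
theorem ncard_edgeSet_restrictTo_deleteEdges [Fintype V] {G : SimpleGraph V} {M : G.Subgraph}
    (hM : M.IsMatching) (I : Finset V) :
    (restrictTo (G.deleteEdges M.edgeSet) I).edgeSet.ncard + M.edgeSet.ncard + I.card
      ≤ (restrictTo G I).edgeSet.ncard + Fintype.card V := by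
  classical
  set A := M.edgeSet ∩ (restrictTo G I).edgeSet with hA
  set B := M.edgeSet \ (restrictTo G I).edgeSet with hB
  have h1 : A.ncard + B.ncard = M.edgeSet.ncard :=
    Set.ncard_inter_add_ncard_sdiff_eq_ncard _ _ (Set.toFinite _)
  have h2 : B.ncard ≤ Iᶜ.card := by
    refine ncard_le_card_of_forall_meets hM Set.sdiff_subset fun e he => ?_
    induction e with
    | h x y =>
      have hxy : G.Adj x y := M.adj_sub he.1
      by_cases hx : x ∈ I
      · refine ⟨y, ?_, by simp⟩
        rw [Finset.mem_compl]
        exact fun hy => he.2 ⟨hxy, hx, hy⟩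
      · exact ⟨x, by simpa using hx, by simp⟩
  have h3 : (restrictTo (G.deleteEdges M.edgeSet) I).edgeSet.ncard + A.ncard
      ≤ (restrictTo G I).edgeSet.ncard := by
    rw [← Set.ncard_union_eq _ (Set.toFinite _) (Set.toFinite _)]
    · refine Set.ncard_le_ncard (Set.union_subset ?_ Set.inter_subset_right) (Set.toFinite _)
      intro e he
      induction e with
      | h x y => exact ⟨(SimpleGraph.deleteEdges_adj.1 he.1).1, he.2⟩
    · rw [Set.disjoint_left]
      intro e he he'
      induction e with
      | h x y => exact (SimpleGraph.deleteEdges_adj.1 he.1).2 he'.1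
  have h4 := Finset.card_add_card_compl I
  omega

/-- The approximation ratio, in the form `(k + 2) |I| ≤ (2 k + 2) |S|`. -/
theorem IsResidualSequence.card_mul_le [Finite V] {G : SimpleGraph V} {k : ℕ}
    {H : ℕ → SimpleGraph V} (hH : IsResidualSequence G k H)
    (hK : ∀ i < k, IsKonigEgervary (H i)) {S : Finset V} (hS : (H k).IsMaximumIndepSet S)
    {I : Finset V} (hI : IsKDependent G k I) : (k + 2) * I.card ≤ (2 * k + 2) * S.card := by
  classical
  cases nonempty_fintype V
  have hstep : ∀ i ≤ k, (restrictTo (H i) I).edgeSet.ncard + i * I.card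
      ≤ (restrictTo G I).edgeSet.ncard + i * S.card := by
    intro i hi
    induction i with
    | zero => simp [hH.1]
    | succ i ih =>
      obtain ⟨M, hM, h⟩ := hH.2 i hi
      have h1 := ncard_edgeSet_restrictTo_deleteEdges hM.1 I
      rw [← h] at h1
      have h2 := (hK i hi).card_le hM (s := S.card) fun T hT =>
        hS.maximum T fun x hx y hy hxy hadj => hT hx hy hxy (hH.anti (by omega) le_rfl hadj)
      have := ih (by omega)
      rw [add_mul, add_mul]
      omega
  obtain ⟨T, hTI, hT, hcard⟩ := exists_isIndepSet_card_add_ncard_edgeSet (restrictTo (H k) I) I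
  have h1 := hS.maximum T fun x hx y hy hxy hadj =>
    hT hx hy hxy ⟨hadj, hTI hx, hTI hy⟩
  have h2 := hstep k le_rfl
  have h3 := hI.two_mul_ncard_edgeSet_restrictTo_le
  nlinarith

theorem IsResidualSequence.isKDependent_and_ratio [Finite V] {G : SimpleGraph V} {k : ℕ}
    {H : ℕ → SimpleGraph V} (hH : IsResidualSequence G k H)
    (hK : ∀ i < k, IsKonigEgervary (H i)) {S : Finset V} (hS : (H k).IsMaximumIndepSet S) :
    IsKDependent G k S ∧ ∀ I : Finset V, IsMaximumKDependent G k I →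
      (I.card : ℝ) ≤ (1 + (k : ℝ) / ((k : ℝ) + 2)) * (S.card : ℝ) := by
  refine ⟨hH.isKDependent hS.isIndepSet, fun I hI => ?_⟩
  have h : ((k : ℝ) + 2) * I.card ≤ (2 * k + 2) * S.card := by
    exact_mod_cast hH.card_mul_le hK hS hI.1
  have hk : (0 : ℝ) < k + 2 := by positivity
  rw [show (1 + (k : ℝ) / ((k : ℝ) + 2)) * (S.card : ℝ) = (2 * k + 2) * S.card / (k + 2) by
    field_simp; ring, le_div_iff₀ hk]
  linarith

end KDep

/-! ### Total correctness with running times for the random access machine -/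

namespace RAM

/-- The state with register `x` set to `v`. -/
def State.setR (σ : State) (x v : ℕ) : State := { σ with reg := Function.update σ.reg x v }

/-- The state with entry `i` of array `a` set to `v`. -/
def State.setA (σ : State) (a i v : ℕ) : State :=
  { σ with arr := Function.update σ.arr a (Function.update (σ.arr a) i v) }

@[simp] theorem State.setR_reg (σ : State) (x v y : ℕ) :
    (σ.setR x v).reg y = if y = x then v else σ.reg y := by
  simp [State.setR, Function.update_apply]

@[simp] theorem State.setR_arr (σ : State) (x v : ℕ) : (σ.setR x v).arr = σ.arr := rfl

@[simp] theorem State.setA_reg (σ : State) (a i v : ℕ) : (σ.setA a i v).reg = σ.reg := rfl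

@[simp] theorem State.setA_arr (σ : State) (a i v b : ℕ) :
    (σ.setA a i v).arr b = if b = a then Function.update (σ.arr a) i v else σ.arr b := by
  simp [State.setA, Function.update_apply]

/-- Weakest precondition for total correctness: `p` started in `σ` halts, in a final state and
after a number of steps that satisfy `Q`. -/
def WP (p : Program) (σ : State) (Q : State → ℕ → Prop) : Prop := ∃ τ t, Exec p σ τ t ∧ Q τ t

theorem WP.mono {p : Program} {σ : State} {Q Q' : State → ℕ → Prop} (h : WP p σ Q)
    (hQ : ∀ τ t, Q τ t → Q' τ t) : WP p σ Q' := by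
  obtain ⟨τ, t, he, hq⟩ := h
  exact ⟨τ, t, he, hQ _ _ hq⟩

theorem WP_skip {σ : State} {Q : State → ℕ → Prop} : WP .skip σ Q ↔ Q σ 1 := by
  constructor
  · rintro ⟨_, _, ⟨⟩, h⟩; exact h
  · exact fun h => ⟨_, _, .skip _, h⟩

theorem WP_assign {x : ℕ} {e : Expr} {σ : State} {Q : State → ℕ → Prop} :
    WP (.assign x e) σ Q ↔ Q (σ.setR x (e.eval σ)) (e.cost + 1) := by
  constructor
  · rintro ⟨_, _, ⟨⟩, h⟩; exact h
  · exact fun h => ⟨_, _, .assign _ _ _, h⟩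

theorem WP_store {a : ℕ} {i e : Expr} {σ : State} {Q : State → ℕ → Prop} :
    WP (.store a i e) σ Q ↔ Q (σ.setA a (i.eval σ) (e.eval σ)) (i.cost + e.cost + 1) := by
  constructor
  · rintro ⟨_, _, ⟨⟩, h⟩; exact h
  · exact fun h => ⟨_, _, .store _ _ _ _, h⟩

theorem WP_seq {p q : Program} {σ : State} {Q : State → ℕ → Prop} :
    WP (.seq p q) σ Q ↔ WP p σ fun τ s => WP q τ fun υ t => Q υ (s + t) := by
  constructor
  · rintro ⟨_, _, h, hq⟩
    cases h with
    | seq h1 h2 => exact ⟨_, _, h1, _, _, h2, hq⟩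
  · rintro ⟨_, _, h1, _, _, h2, h⟩; exact ⟨_, _, .seq h1 h2, h⟩

theorem WP_ite {b : Test} {p q : Program} {σ : State} {Q : State → ℕ → Prop} :
    WP (.ite b p q) σ Q ↔ (b.Holds σ → WP p σ fun τ t => Q τ (b.cost + t)) ∧
      (¬ b.Holds σ → WP q σ fun τ t => Q τ (b.cost + t)) := by
  constructor
  · rintro ⟨_, _, h, hq⟩
    cases h with
    | ite_true hb h => exact ⟨fun _ => ⟨_, _, h, hq⟩, fun hn => absurd hb hn⟩
    | ite_false hb h => exact ⟨fun hn => absurd hn hb, fun _ => ⟨_, _, h, hq⟩⟩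
  · rintro ⟨h1, h2⟩
    by_cases hb : b.Holds σ
    · obtain ⟨_, _, h, hq⟩ := h1 hb; exact ⟨_, _, .ite_true hb h, hq⟩
    · obtain ⟨_, _, h, hq⟩ := h2 hb; exact ⟨_, _, .ite_false hb h, hq⟩

/-- The loop rule, with an amortized time bound.  The invariant `I σ φ` says that `φ` steps are
still available in state `σ`; every iteration pays for its own steps.  Since an iteration takes at
least one step, the loop terminates. -/
theorem WP_loop {b : Test} {p : Program} (I : State → ℕ → Prop)
    (hbody : ∀ σ φ, I σ φ → b.Holds σ →
      WP p σ fun τ t => ∃ φ', I τ φ' ∧ b.cost + t + φ' ≤ φ) {σ : State} {φ : ℕ} (h : I σ φ) :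
    WP (.loop b p) σ fun τ t => ¬ b.Holds τ ∧ ∃ φ', I τ φ' ∧ t + φ' ≤ φ + b.cost := by
  have hcost : 0 < b.cost := by cases b <;> simp [Test.cost]
  induction φ using Nat.strong_induction_on generalizing σ with
  | _ φ ih =>
    by_cases hb : b.Holds σ
    · obtain ⟨τ, t, he, φ', hI, hφ⟩ := hbody σ φ h hb
      obtain ⟨υ, s, he', hn, φ'', hI', hφ'⟩ := ih φ' (by omega) hI
      exact ⟨υ, _, .loop_true hb he he', hn, φ'', hI', by omega⟩
    · exact ⟨σ, _, .loop_false hb, hb, φ, h, by omega⟩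

/-- The registers that a program may change. -/
def Program.modR : Program → List ℕ
  | .skip => []
  | .assign x _ => [x]
  | .store _ _ _ => []
  | .seq p q => p.modR ++ q.modR
  | .ite _ p q => p.modR ++ q.modR
  | .loop _ p => p.modR

/-- The arrays that a program may change. -/
def Program.modA : Program → List ℕ
  | .skip => []
  | .assign _ _ => []
  | .store a _ _ => [a]
  | .seq p q => p.modA ++ q.modA
  | .ite _ p q => p.modA ++ q.modA
  | .loop _ p => p.modA

/-- Registers and arrays that do not occur on a left-hand side keep their contents. -/
theorem Exec.frame {p : Program} {σ τ : State} {t : ℕ} (h : Exec p σ τ t) :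
    (∀ x ∉ p.modR, τ.reg x = σ.reg x) ∧ ∀ a ∉ p.modA, τ.arr a = σ.arr a := by
  induction h with
  | skip => simp
  | assign x e σ =>
    refine ⟨fun y hy => ?_, fun _ _ => rfl⟩
    simp only [Program.modR, List.mem_singleton] at hy
    simp [hy]
  | store a i e σ =>
    refine ⟨fun _ _ => rfl, fun y hy => ?_⟩
    simp only [Program.modA, List.mem_singleton] at hy
    simp [hy]
  | seq _ _ ih1 ih2 =>
    simp only [Program.modR, Program.modA, List.mem_append, not_or]
    exact ⟨fun x hx => (ih2.1 x hx.2).trans (ih1.1 x hx.1),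
      fun x hx => (ih2.2 x hx.2).trans (ih1.2 x hx.1)⟩
  | ite_true _ _ ih =>
    simp only [Program.modR, Program.modA, List.mem_append, not_or]
    exact ⟨fun x hx => ih.1 x hx.1, fun x hx => ih.2 x hx.1⟩
  | ite_false _ _ ih =>
    simp only [Program.modR, Program.modA, List.mem_append, not_or]
    exact ⟨fun x hx => ih.1 x hx.2, fun x hx => ih.2 x hx.2⟩
  | loop_true _ _ _ ih1 ih2 =>
    exact ⟨fun x hx => (ih2.1 x hx).trans (ih1.1 x hx),
      fun x hx => (ih2.2 x hx).trans (ih1.2 x hx)⟩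
  | loop_false => simp

theorem WP.frame {p : Program} {σ : State} {Q : State → ℕ → Prop} (h : WP p σ Q) :
    WP p σ fun τ t => Q τ t ∧ (∀ x ∉ p.modR, τ.reg x = σ.reg x) ∧
      ∀ a ∉ p.modA, τ.arr a = σ.arr a := by
  obtain ⟨τ, t, he, hq⟩ := h
  exact ⟨τ, t, he, hq, he.frame⟩

/-- `for j := 0, …, N - 1`, where `N` is the content of register `N`. -/
def forLoop (j N : ℕ) (p : Program) : Program :=
  .seq (.assign j (.lit 0))
    (.loop (.lt (.var j) (.var N)) (.seq p (.assign j (.succ (.var j)))))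

/-- The rule for `forLoop`: each iteration may spend `c` steps of its own besides the credit `φ`
carried by the invariant. -/
theorem WP_forLoop {j N : ℕ} {p : Program} (hjN : j ≠ N) (hj : j ∉ p.modR) (hN : N ∉ p.modR)
    {n c : ℕ} (I : ℕ → State → ℕ → Prop)
    (hbody : ∀ i < n, ∀ σ φ, I i σ φ → σ.reg j = i →
      WP p σ fun τ t => ∃ φ', I (i + 1) (τ.setR j (i + 1)) φ' ∧ t + φ' ≤ φ + c)
    {σ : State} {φ : ℕ} (hn : σ.reg N = n) (h : I 0 (σ.setR j 0) φ) :
    WP (forLoop j N p) σ fun τ t => ∃ φ', I n τ φ' ∧ t + φ' ≤ φ + n * (c + 6) + 5 := by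
  rw [forLoop, WP_seq, WP_assign]
  refine (WP_loop (fun τ ψ => ∃ i φ', i ≤ n ∧ τ.reg j = i ∧ τ.reg N = n ∧ I i τ φ' ∧
    φ' + (n - i) * (c + 6) = ψ) ?_ (φ := φ + n * (c + 6)) ?_).mono ?_
  · rintro τ ψ ⟨i, φ', hi, hτj, hτN, hI, rfl⟩ hb
    simp only [Test.Holds, Expr.eval, hτj, hτN] at hb
    rw [WP_seq]
    refine (hbody i hb τ φ' hI hτj).frame.mono ?_
    rintro υ t ⟨⟨φ'', hI', ht⟩, hfr, -⟩
    rw [WP_assign]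
    refine ⟨φ'' + (n - (i + 1)) * (c + 6), ⟨i + 1, φ'', hb, ?_, ?_, ?_, rfl⟩, ?_⟩
    · simp [Expr.eval, hfr j hj, hτj]
    · simp [hjN.symm, hfr N hN, hτN]
    · simpa [Expr.eval, hfr j hj, hτj] using hI'
    · obtain ⟨d, rfl⟩ := Nat.exists_eq_add_of_lt hb
      have h1 : i + d + 1 - i = d + 1 := by omega
      have h2 : i + d + 1 - (i + 1) = d := by omega
      simp only [Test.cost, Expr.cost, h1, h2, add_mul]
      omega
  · exact ⟨0, φ, by omega, by simp [Expr.eval], by simp [hjN.symm, hn],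
      by simpa [Expr.eval] using h, by simp⟩
  · rintro τ t ⟨hb, ψ, ⟨i, φ', hi, hτj, hτN, hI, rfl⟩, ht⟩
    simp only [Test.Holds, Expr.eval, hτj, hτN] at hb
    obtain rfl : i = n := by omega
    refine ⟨φ', hI, ?_⟩
    simp only [Test.cost, Expr.cost] at ht ⊢
    omega

/-- Lowering one summand lowers the sum. -/
theorem sum_add_le_sum_of_le_of_add_le {ι : Type*} {s : Finset ι} {f g : ι → ℕ} {d : ℕ}
    (h : ∀ i ∈ s, f i ≤ g i) {i : ι} (hi : i ∈ s) (hd : f i + d ≤ g i) :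
    ∑ i ∈ s, f i + d ≤ ∑ i ∈ s, g i := by
  classical
  rw [← Finset.add_sum_erase s f hi, ← Finset.add_sum_erase s g hi]
  have := Finset.sum_le_sum (s := s.erase i) fun j hj => h j (Finset.mem_of_mem_erase hj)
  omega

/-! ### Matchings of an arc list -/

/-- A bipartite multigraph as the machine stores it: arc `e < m` leads from `l e` to `r e`, and the
arcs with the same left end form a linked list with head `hd` and successor function `nx`.  Links
are arc numbers plus one, `0` ends a list, and arc numbers decrease along it. -/
structure ArcList where
  m : ℕ
  l : ℕ → ℕ
  r : ℕ → ℕ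
  hd : ℕ → ℕ
  nx : ℕ → ℕ

namespace ArcList

/-- `c` is a link to an arc with left end `u`, or the end of the list. -/
def Ptr (A : ArcList) (u c : ℕ) : Prop := ∀ e, c = e + 1 → e < A.m ∧ A.l e = u

/-- The linked lists are correct: following `nx` from `hd u` visits every arc with left end `u`.
This is expressed by order: no such arc lies between an arc and its successor. -/
structure Ok (A : ArcList) : Prop where
  lt_hd : ∀ e < A.m, e < A.hd (A.l e)
  ptr_hd : ∀ u, A.Ptr u (A.hd u)
  ptr_nx : ∀ e < A.m, A.Ptr (A.l e) (A.nx e)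
  nx_le : ∀ e < A.m, A.nx e ≤ e
  lt_nx : ∀ e < A.m, ∀ e' < e, A.l e' = A.l e → e' < A.nx e

/-- `ml` and `mr` store a matching of alive arcs (those with `dd e = 0`): the link of the matched
arc at each left and right vertex, or `0`.  The entries of `mr` in `X` are arbitrary, and no
matched arc ends in `X`. -/
structure Consistent (A : ArcList) (dd ml mr : ℕ → ℕ) (X : Set ℕ) : Prop where
  left : ∀ e < A.m, ∀ f, ml (A.l e) = f + 1 →
    f < A.m ∧ A.l f = A.l e ∧ dd f = 0 ∧ A.r f ∉ X ∧ mr (A.r f) = f + 1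
  right : ∀ e < A.m, ∀ g, A.r e ∉ X → mr (A.r e) = g + 1 →
    g < A.m ∧ A.r g = A.r e ∧ ml (A.l g) = g + 1

/-- The set of matched arcs. -/
def matched (A : ArcList) (ml : ℕ → ℕ) : Finset ℕ :=
  (Finset.range A.m).filter fun e => ml (A.l e) = e + 1

variable {A : ArcList} {dd ml mr p lev cur par q : ℕ → ℕ}

theorem mem_matched {e : ℕ} : e ∈ A.matched ml ↔ e < A.m ∧ ml (A.l e) = e + 1 := by
  simp [matched]

theorem injOn_l_matched : Set.InjOn A.l (A.matched ml) := by
  intro e he e' he' h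
  have h1 := (mem_matched.1 he).2
  have h2 := (mem_matched.1 he').2
  rw [h] at h1; omega

theorem Consistent.injOn_r_matched {X : Set ℕ} (h : A.Consistent dd ml mr X) :
    Set.InjOn A.r (A.matched ml) := by
  intro e he e' he' hr
  obtain ⟨h1, h2⟩ := mem_matched.1 he
  obtain ⟨h1', h2'⟩ := mem_matched.1 he'
  have h3 := (h.left e h1 e h2).2.2.2.2
  have h4 := (h.left e' h1' e' h2').2.2.2.2
  rw [hr] at h3; omega

theorem card_matched_update_free {e : ℕ} (he : e < A.m) (h : ml (A.l e) = 0) :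
    (A.matched (Function.update ml (A.l e) (e + 1))).card = (A.matched ml).card + 1 := by
  have : A.matched (Function.update ml (A.l e) (e + 1)) = insert e (A.matched ml) := by
    ext f; simp only [Finset.mem_insert, mem_matched, Function.update_apply]; grind
  rw [this, Finset.card_insert_of_notMem]
  simp [mem_matched, h]

theorem Consistent.card_matched_update {X : Set ℕ} (hc : A.Consistent dd ml mr X) {e f : ℕ}
    (he : e < A.m) (h : ml (A.l e) = f + 1) (hr : A.r e ∈ X) :
    (A.matched (Function.update ml (A.l e) (e + 1))).card = (A.matched ml).card := by
  obtain ⟨h1, h2, -, h3, -⟩ := hc.left e he f h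
  have hef : e ≠ f := fun hef => h3 (hef ▸ hr)
  have hf : f ∈ A.matched ml := mem_matched.2 ⟨h1, by rw [h2, h]⟩
  have : A.matched (Function.update ml (A.l e) (e + 1)) = insert e ((A.matched ml).erase f) := by
    ext f; simp only [Finset.mem_insert, Finset.mem_erase, mem_matched, Function.update_apply]
    grind
  rw [this, Finset.card_insert_of_notMem, Finset.card_erase_of_mem hf]
  · have := Finset.card_pos.2 ⟨f, hf⟩; omega
  · simp only [Finset.mem_erase, mem_matched, not_and]
    intro _ _ h'; rw [h] at h'; omega

/-- If the arc matched at `v` is given up at its left end only, the entry at `v` becomes stale. -/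
theorem Consistent.unmatch {f v : ℕ} (hv : ∃ e < A.m, A.r e = v)
    (h : A.Consistent dd ml mr ∅) (hf : mr v = f + 1) :
    A.Consistent dd (Function.update ml (A.l f) 0) mr {v} := by
  obtain ⟨e, he, rfl⟩ := hv
  obtain ⟨h1, h2, h3⟩ := h.right e he f (by simp) hf
  have hl := h.left; have hr := h.right
  constructor
  · simp only [Function.update_apply, Set.mem_singleton_iff, Set.mem_empty_iff_false] at *
    grind
  · simp only [Function.update_apply, Set.mem_singleton_iff, Set.mem_empty_iff_false] at *
    grind

theorem Consistent.weaken {v : ℕ} (hv : ∃ e < A.m, A.r e = v) (h : A.Consistent dd ml mr ∅)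
    (hf : mr v = 0) : A.Consistent dd ml mr {v} := by
  obtain ⟨e, he, rfl⟩ := hv
  have hl := h.left; have hr := h.right
  constructor
  · simp only [Set.mem_singleton_iff, Set.mem_empty_iff_false] at *
    grind
  · simp only [Set.mem_empty_iff_false] at *
    grind

/-- Match `e` when its left end is free and the entry at its right end is stale. -/
theorem Consistent.match_free {e : ℕ} (he : e < A.m) (hd : dd e = 0)
    (h : A.Consistent dd ml mr {A.r e}) (hf : ml (A.l e) = 0) :
    A.Consistent dd (Function.update ml (A.l e) (e + 1)) (Function.update mr (A.r e) (e + 1))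
      ∅ := by
  have hl := h.left; have hr := h.right
  constructor
  · simp only [Function.update_apply, Set.mem_singleton_iff, Set.mem_empty_iff_false] at *
    grind
  · simp only [Function.update_apply, Set.mem_singleton_iff, Set.mem_empty_iff_false] at *
    grind

/-- Match `e` instead of the arc `f` with the same left end: now the entry at `r f` is stale. -/
theorem Consistent.rematch {e f : ℕ} (he : e < A.m) (hd : dd e = 0)
    (h : A.Consistent dd ml mr {A.r e}) (hf : ml (A.l e) = f + 1) :
    A.Consistent dd (Function.update ml (A.l e) (e + 1)) (Function.update mr (A.r e) (e + 1))
      {A.r f} := by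
  have hl := h.left; have hr := h.right
  have := hl e he f hf
  constructor
  · simp only [Function.update_apply, Set.mem_singleton_iff] at *
    grind
  · simp only [Function.update_apply, Set.mem_singleton_iff] at *
    grind

/-! ### The auction -/

/-- The invariant of the auction with level bound `L`.  Left vertex `u` has a level `lev u` and
right vertex `v` a price `p v`; `cur u` points to the next arc to be scanned from `u` at its
level.  Since prices never fall, an arc scanned at the current level and found too expensive
remains so (`scanned`). -/
structure Auction (A : ArcList) (L : ℕ) (dd ml mr p lev cur : ℕ → ℕ) : Prop where
  cons : A.Consistent dd ml mr ∅
  ptr : ∀ e < A.m, A.Ptr (A.l e) (cur (A.l e))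
  lev_le_price : ∀ e < A.m, dd e = 0 → lev (A.l e) ≤ p (A.r e)
  scanned : ∀ e < A.m, dd e = 0 → cur (A.l e) ≤ e → lev (A.l e) < p (A.r e)
  price_matched : ∀ e < A.m, ml (A.l e) = e + 1 → p (A.r e) = lev (A.l e) + 1
  price_free : ∀ e < A.m, mr (A.r e) = 0 → p (A.r e) = 0
  lev_le : ∀ e < A.m, lev (A.l e) ≤ L + 1

variable {L : ℕ}

theorem Auction.init (hA : A.Ok) (h : ∀ e < A.m, ml (A.l e) = 0 ∧ mr (A.r e) = 0 ∧ p (A.r e) = 0 ∧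
    lev (A.l e) = 0 ∧ cur (A.l e) = A.hd (A.l e)) : A.Auction L dd ml mr p lev cur where
  cons := ⟨fun e he f hf => by simp [(h e he).1] at hf,
    fun e he f _ hf => by simp [(h e he).2.1] at hf⟩
  ptr e he := by rw [(h e he).2.2.2.2]; exact hA.ptr_hd _
  lev_le_price e he _ := by simp [(h e he).2.2.2.1]
  scanned e he _ hc := by have := hA.lt_hd e he; rw [(h e he).2.2.2.2] at hc; omega
  price_matched e he hf := by simp [(h e he).1] at hf
  price_free e he _ := (h e he).2.2.1
  lev_le e he := by simp [(h e he).2.2.2.1]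

/-- The free left vertex `x` has scanned its whole list and rises by one level. -/
theorem Auction.bump (hA : A.Ok) (h : A.Auction L dd ml mr p lev cur) {x : ℕ} (hx : ml x = 0)
    (hc : cur x = 0) (hL : lev x ≤ L) :
    A.Auction L dd ml mr p (Function.update lev x (lev x + 1))
      (Function.update cur x (A.hd x)) := by
  obtain ⟨h1, h2, h3, h4, h5, h6, h7⟩ := h
  have h8 := hA.lt_hd
  have h9 := hA.ptr_hd
  constructor <;> (try simp only [Function.update_apply]) <;> grind

/-- The scanned arc is dead or too expensive. -/
theorem Auction.advance (hA : A.Ok) (h : A.Auction L dd ml mr p lev cur) {e : ℕ}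
    (he : e < A.m) (hc : cur (A.l e) = e + 1) (hd : dd e = 0 → lev (A.l e) < p (A.r e)) :
    A.Auction L dd ml mr p lev (Function.update cur (A.l e) (A.nx e)) := by
  obtain ⟨h1, h2, h3, h4, h5, h6, h7⟩ := h
  have h8 := hA.lt_nx e he
  have h9 := hA.ptr_nx e he
  constructor <;> (try simp only [Function.update_apply]) <;> grind

/-- A bid of the free left vertex `l e` for the free right vertex `r e`. -/
theorem Auction.bid_free (hA : A.Ok) (h : A.Auction L dd ml mr p lev cur) {e : ℕ}
    (he : e < A.m) (hc : cur (A.l e) = e + 1) (hd : dd e = 0) (hp : p (A.r e) = lev (A.l e))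
    (hm : ml (A.l e) = 0) (hr : mr (A.r e) = 0) :
    A.Auction L dd (Function.update ml (A.l e) (e + 1)) (Function.update mr (A.r e) (e + 1))
      (Function.update p (A.r e) (p (A.r e) + 1)) lev
      (Function.update cur (A.l e) (A.nx e)) := by
  have hcons := (h.cons.weaken ⟨e, he, rfl⟩ hr).match_free he hd hm
  have hl := h.cons.left
  simp only [Set.mem_empty_iff_false] at hl
  obtain ⟨h1, h2, h3, h4, h5, h6, h7⟩ := h
  have h8 := hA.lt_nx e he
  have h9 := hA.ptr_nx e he
  refine ⟨hcons, ?_, ?_, ?_, ?_, ?_, ?_⟩ <;> (try simp only [Function.update_apply]) <;> grind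

/-- A bid of the free left vertex `l e` for the right vertex `r e` matched by the arc `f`. -/
theorem Auction.bid_matched (hA : A.Ok) (h : A.Auction L dd ml mr p lev cur) {e f : ℕ}
    (he : e < A.m) (hc : cur (A.l e) = e + 1) (hd : dd e = 0) (hp : p (A.r e) = lev (A.l e))
    (hm : ml (A.l e) = 0) (hr : mr (A.r e) = f + 1) :
    A.Auction L dd (Function.update (Function.update ml (A.l e) (e + 1)) (A.l f) 0)
      (Function.update mr (A.r e) (e + 1))
      (Function.update p (A.r e) (p (A.r e) + 1)) lev
      (Function.update cur (A.l e) (A.nx e)) := by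
  obtain ⟨hf, hfr, hfl⟩ := h.cons.right e he f (by simp) hr
  have hne : A.l e ≠ A.l f := fun hn => by rw [hn] at hm; omega
  have hcons := (h.cons.unmatch ⟨e, he, rfl⟩ hr).match_free he hd
    (by rw [Function.update_of_ne hne, hm])
  rw [Function.update_comm hne.symm] at hcons
  have hl := h.cons.left
  simp only [Set.mem_empty_iff_false] at hl
  obtain ⟨h1, h2, h3, h4, h5, h6, h7⟩ := h
  have h8 := hA.lt_nx e he
  have h9 := hA.ptr_nx e he
  refine ⟨hcons, ?_, ?_, ?_, ?_, ?_, ?_⟩ <;> (try simp only [Function.update_apply]) <;> grind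

/-- The credit that pays for the remaining iterations of the auction at `K` steps each: every arc
pays for being scanned once per level, and may pay for one rise of its left end per level. -/
def auctionCredit (A : ArcList) (L K : ℕ) (lev cur : ℕ → ℕ) : ℕ :=
  ∑ e ∈ Finset.range A.m,
    ((L + 1 - lev (A.l e)) * (2 * K) + if e < cur (A.l e) then K else 0)

theorem auctionCredit_le {K : ℕ} : A.auctionCredit L K lev cur ≤ A.m * ((L + 2) * (2 * K)) := by
  refine (Finset.sum_le_card_nsmul _ _ ((L + 2) * (2 * K)) fun e _ => ?_).trans (by simp)
  have : (L + 1 - lev (A.l e)) * (2 * K) ≤ (L + 1) * (2 * K) :=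
    Nat.mul_le_mul_right _ (by omega)
  rw [show (L + 2) * (2 * K) = (L + 1) * (2 * K) + 2 * K by ring]
  split_ifs <;> omega

theorem auctionCredit_bump {K x : ℕ} (hx : ∃ e < A.m, A.l e = x) (hc : cur x = 0)
    (hL : lev x ≤ L) :
    A.auctionCredit L K (Function.update lev x (lev x + 1)) (Function.update cur x (A.hd x)) + K
      ≤ A.auctionCredit L K lev cur := by
  obtain ⟨e, he, rfl⟩ := hx
  have h1 : (L + 1 - lev (A.l e)) * (2 * K)
      = (L + 1 - (lev (A.l e) + 1)) * (2 * K) + 2 * K := by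
    rw [← Nat.succ_mul]; congr 1; omega
  refine sum_add_le_sum_of_le_of_add_le (fun f _ => ?_) (Finset.mem_range.2 he) ?_
  · by_cases h : A.l f = A.l e
    · simp only [h, Function.update_self, hc]
      split_ifs <;> omega
    · simp [Function.update_of_ne h]
  · simp only [Function.update_self, hc]
    split_ifs <;> omega

theorem auctionCredit_advance {K e : ℕ} (hA : A.Ok) (he : e < A.m) (hc : cur (A.l e) = e + 1) :
    A.auctionCredit L K lev (Function.update cur (A.l e) (A.nx e)) + K
      ≤ A.auctionCredit L K lev cur := by
  have := hA.nx_le e he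
  refine sum_add_le_sum_of_le_of_add_le (fun f _ => ?_) (Finset.mem_range.2 he) ?_
  · by_cases h : A.l f = A.l e
    · simp only [h, Function.update_self, hc]
      split_ifs <;> omega
    · simp [Function.update_of_ne h]
  · simp only [Function.update_self, hc]
    split_ifs <;> omega

/-- Sums of vertex weights over two sets of arcs with distinct ends, where the ends of the second
set include all ends of nonzero weight of the first. -/
theorem sum_comp_le_sum_comp {g w : ℕ → ℕ} {s t : Finset ℕ} (hs : Set.InjOn g s)
    (ht : Set.InjOn g t) (h : ∀ e ∈ s, w (g e) ≠ 0 → ∃ f ∈ t, g f = g e) :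
    ∑ e ∈ s, w (g e) ≤ ∑ e ∈ t, w (g e) := by
  rw [← Finset.sum_image hs, ← Finset.sum_image ht]
  refine Finset.sum_le_sum_of_ne_zero fun v hv hw => ?_
  obtain ⟨e, he, rfl⟩ := Finset.mem_image.1 hv
  obtain ⟨f, hf, hfe⟩ := h e he hw
  exact Finset.mem_image.2 ⟨f, hf, hfe⟩

/-- Once every free left vertex has level `L + 1`, the matching is almost maximum.  The weights
`L + 1 - lev u` and `p v` add up to at least `L + 1` on every alive arc and to `L + 2` on every
matched one, and they vanish at free vertices: a fractional vertex cover. -/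
theorem Auction.card_le (h : A.Auction L dd ml mr p lev cur)
    (hfree : ∀ e < A.m, ml (A.l e) = 0 → lev (A.l e) = L + 1) {ml' mr' : ℕ → ℕ} {X : Set ℕ}
    (h' : A.Consistent dd ml' mr' X) :
    (L + 1) * (A.matched ml').card ≤ (L + 2) * (A.matched ml).card := by
  have h1 : ∑ e ∈ A.matched ml', (L + 1 - lev (A.l e)) ≤
      ∑ e ∈ A.matched ml, (L + 1 - lev (A.l e)) := by
    refine sum_comp_le_sum_comp (w := fun u => L + 1 - lev u) injOn_l_matched injOn_l_matched
      fun e he hw => ?_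
    have he := (mem_matched.1 he).1
    obtain ⟨f, hf⟩ := Nat.exists_eq_succ_of_ne_zero (n := ml (A.l e)) fun h0 => by
      rw [hfree e he h0] at hw; simp at hw
    obtain ⟨hf1, hf2, -⟩ := h.cons.left e he f hf
    exact ⟨f, mem_matched.2 ⟨hf1, by rw [hf2, hf]⟩, hf2⟩
  have h2 : ∑ e ∈ A.matched ml', p (A.r e) ≤ ∑ e ∈ A.matched ml, p (A.r e) := by
    refine sum_comp_le_sum_comp h'.injOn_r_matched h.cons.injOn_r_matched fun e he hw => ?_
    have he := (mem_matched.1 he).1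
    obtain ⟨g, hg⟩ := Nat.exists_eq_succ_of_ne_zero fun h0 => hw (h.price_free e he h0)
    obtain ⟨hg1, hg2, hg3⟩ := h.cons.right e he g (by simp) hg
    exact ⟨g, mem_matched.2 ⟨hg1, hg3⟩, hg2⟩
  have h3 : (L + 1) * (A.matched ml').card ≤
      ∑ e ∈ A.matched ml', ((L + 1 - lev (A.l e)) + p (A.r e)) := by
    rw [mul_comm, ← smul_eq_mul]
    refine Finset.card_nsmul_le_sum _ _ _ fun e he => ?_
    obtain ⟨he, hm⟩ := mem_matched.1 he
    have := h.lev_le_price e he (h'.left e he e hm).2.2.1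
    omega
  have h4 : ∑ e ∈ A.matched ml, ((L + 1 - lev (A.l e)) + p (A.r e)) ≤
      (L + 2) * (A.matched ml).card := by
    rw [mul_comm, ← smul_eq_mul]
    refine Finset.sum_le_card_nsmul _ _ _ fun e he => ?_
    obtain ⟨he, hm⟩ := mem_matched.1 he
    have := h.price_matched e he hm
    have := h.lev_le e he
    omega
  rw [Finset.sum_add_distrib] at h3 h4
  omega

/-! ### Breadth-first search for an augmenting path -/

/-- The invariant of the breadth-first search along alternating paths from the free left vertices.
The queue of left vertices is `q 0, …, q (tail - 1)`, of which those before `qh` are finished;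
`par v` is the link of the arc by which the right vertex `v` was reached, or `0`; `cur u` points to
the next arc to be scanned from `u`; `fd` is `0` until a free right vertex is reached, and then the
link of the arc leading to it. -/
structure Search (A : ArcList) (dd ml mr cur par q : ℕ → ℕ) (qh tail fd : ℕ) : Prop where
  ptr : ∀ e < A.m, A.Ptr (A.l e) (cur (A.l e))
  closed : ∀ e < A.m, dd e = 0 → cur (A.l e) ≤ e → par (A.r e) ≠ 0
  parent : ∀ e < A.m, ∀ g, par (A.r e) = g + 1 →
    g < A.m ∧ A.r g = A.r e ∧ dd g = 0 ∧ ∃ i < tail, q i = A.l g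
  visited : fd = 0 → ∀ e < A.m, par (A.r e) ≠ 0 →
    ∃ f, mr (A.r e) = f + 1 ∧ ∃ i < tail, q i = A.l f
  queue_mem : ∀ i < tail, ∃ e < A.m, q i = A.l e
  queue_parent : ∀ i < tail, ∀ f, ml (q i) = f + 1 →
    ∃ g, par (A.r f) = g + 1 ∧ ∃ i' < i, q i' = A.l g
  finished : fd = 0 → ∀ i < qh, cur (q i) = 0
  roots : ∀ e < A.m, ml (A.l e) = 0 → ∃ i < tail, q i = A.l e
  found : ∀ g, fd = g + 1 → g < A.m ∧ dd g = 0 ∧ mr (A.r g) = 0 ∧ ∃ i < tail, q i = A.l g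
  qh_eq : fd ≠ 0 → qh = tail
  qh_le : qh ≤ tail

variable {qh tail fd : ℕ}

theorem Search.init (hA : A.Ok)
    (h : ∀ e < A.m, cur (A.l e) = A.hd (A.l e) ∧ par (A.r e) = 0)
    (hq : ∀ i < tail, ∃ e < A.m, q i = A.l e ∧ ml (A.l e) = 0)
    (hr : ∀ e < A.m, ml (A.l e) = 0 → ∃ i < tail, q i = A.l e) :
    A.Search dd ml mr cur par q 0 tail 0 where
  ptr e he := by rw [(h e he).1]; exact hA.ptr_hd _
  closed e he _ hc := by have := hA.lt_hd e he; rw [(h e he).1] at hc; omega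
  parent e he g hg := by rw [(h e he).2] at hg; omega
  visited _ e he hg := absurd (h e he).2 hg
  queue_mem i hi := by obtain ⟨e, he, hq, -⟩ := hq i hi; exact ⟨e, he, hq⟩
  queue_parent i hi f hf := by obtain ⟨e, he, hq, hm⟩ := hq i hi; rw [hq, hm] at hf; omega
  finished _ i hi := by omega
  roots := hr
  found g hg := by omega
  qh_eq h := absurd rfl h
  qh_le := Nat.zero_le _

/-- The first vertex of the queue has no more arcs to scan. -/
theorem Search.next (h : A.Search dd ml mr cur par q qh tail fd) (hq : qh < tail)
    (hc : cur (q qh) = 0) : A.Search dd ml mr cur par q (qh + 1) tail fd := by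
  obtain ⟨h1, h2, h3, h4, h5, h6, h7, h8, h9, h10, h11⟩ := h
  refine ⟨h1, h2, h3, h4, h5, h6, fun h0 i hi => ?_, h8, h9, fun h0 => ?_, hq⟩
  · rcases Nat.lt_succ_iff_lt_or_eq.1 hi with hi | rfl
    · exact h7 h0 i hi
    · exact hc
  · have := h10 h0; omega

/-- The scanned arc is dead, or its right end was reached before. -/
theorem Search.advance (hA : A.Ok) (h : A.Search dd ml mr cur par q qh tail fd) {e : ℕ}
    (he : e < A.m) (hc : cur (A.l e) = e + 1) (hd : dd e = 0 → par (A.r e) ≠ 0) :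
    A.Search dd ml mr (Function.update cur (A.l e) (A.nx e)) par q qh tail fd := by
  obtain ⟨h1, h2, h3, h4, h5, h6, h7, h8, h9, h10, h11⟩ := h
  have hl := hA.lt_nx e he
  have hp := hA.ptr_nx e he
  refine ⟨?_, ?_, h3, h4, h5, h6, ?_, h8, h9, h10, h11⟩ <;> simp only [Function.update_apply] <;>
    grind

/-- The search ends at a free right vertex; emptying the queue makes the loop stop. -/
theorem Search.visit_free (hA : A.Ok) (h : A.Search dd ml mr cur par q qh tail fd) {e : ℕ}
    (hq : qh < tail) (he : e < A.m) (hqe : q qh = A.l e) (hc : cur (A.l e) = e + 1) (hd : dd e = 0)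
    (hp : par (A.r e) = 0) (hm : mr (A.r e) = 0) :
    A.Search dd ml mr (Function.update cur (A.l e) (A.nx e))
      (Function.update par (A.r e) (e + 1)) q tail tail (e + 1) := by
  obtain ⟨h1, h2, h3, h4, h5, h6, h7, h8, h9, h10, h11⟩ := h
  have hl := hA.lt_nx e he
  have hn := hA.ptr_nx e he
  refine ⟨?_, ?_, fun e' he' g hg => ?_, fun h0 => absurd h0 (by omega), h5,
    fun i hi f' hf' => ?_, fun h0 => absurd h0 (by omega), h8, fun g hg => ?_, fun _ => rfl,
    le_rfl⟩
  · simp only [Function.update_apply]; grind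
  · simp only [Function.update_apply]; grind
  · by_cases hee : A.r e' = A.r e
    · rw [hee, Function.update_self] at hg
      obtain rfl : e = g := by omega
      exact ⟨he, hee.symm, hd, qh, hq, hqe⟩
    · rw [Function.update_of_ne hee] at hg
      exact h3 e' he' g hg
  · obtain ⟨g, hg, hi'⟩ := h6 i hi f' hf'
    refine ⟨g, ?_, hi'⟩
    rw [Function.update_of_ne, hg]
    intro hr; rw [hr, hp] at hg; omega
  · obtain rfl : e = g := by omega
    exact ⟨he, hd, hm, qh, hq, hqe⟩

/-- A new matched right vertex is reached, and its partner `l f` enters the queue. -/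
theorem Search.visit_matched (hA : A.Ok) (hcons : A.Consistent dd ml mr ∅)
    (h : A.Search dd ml mr cur par q qh tail fd) {e f : ℕ} (hq : qh < tail)
    (he : e < A.m) (hqe : q qh = A.l e) (hc : cur (A.l e) = e + 1) (hd : dd e = 0)
    (hp : par (A.r e) = 0) (hm : mr (A.r e) = f + 1) :
    A.Search dd ml mr (Function.update cur (A.l e) (A.nx e))
      (Function.update par (A.r e) (e + 1)) (Function.update q tail (A.l f)) qh (tail + 1) fd := by
  obtain ⟨hf1, hf2, hf3⟩ := hcons.right e he f (by simp) hm
  have hl := hA.lt_nx e he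
  have hn := hA.ptr_nx e he
  obtain ⟨h1, h2, h3, h4, h5, h6, h7, h8, h9, h10, h11⟩ := h
  have hfd : fd = 0 := by by_contra h0; have := h10 h0; omega
  have hcl := hcons.left
  refine ⟨?_, ?_, ?_, ?_, ?_, ?_, ?_, ?_, ?_, ?_, ?_⟩
  · simp only [Function.update_apply]; grind
  · simp only [Function.update_apply]; grind
  · intro e' he' g hg
    have key : g < A.m ∧ A.r g = A.r e' ∧ dd g = 0 ∧ ∃ i < tail, q i = A.l g := by
      by_cases hee : A.r e' = A.r e
      · rw [hee, Function.update_self] at hg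
        obtain rfl : e = g := by omega
        exact ⟨he, hee.symm, hd, qh, hq, hqe⟩
      · rw [Function.update_of_ne hee] at hg
        exact h3 e' he' g hg
    obtain ⟨k1, k2, k3, i, hi, k4⟩ := key
    exact ⟨k1, k2, k3, i, by omega, by rw [Function.update_of_ne (by omega), k4]⟩
  · intro _ e' he' hg
    by_cases hee : A.r e' = A.r e
    · exact ⟨f, by rw [hee, hm], tail, by omega, by simp⟩
    · rw [Function.update_of_ne hee] at hg
      obtain ⟨f', hf', i, hi, hqi⟩ := h4 hfd e' he' hg
      exact ⟨f', hf', i, by omega, by rw [Function.update_of_ne (by omega), hqi]⟩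
  · intro i hi
    rcases Nat.lt_succ_iff_lt_or_eq.1 hi with hi | rfl
    · rw [Function.update_of_ne (by omega)]; exact h5 i hi
    · exact ⟨f, hf1, by simp⟩
  · intro i hi f' hf'
    rcases Nat.lt_succ_iff_lt_or_eq.1 hi with hi | rfl
    · rw [Function.update_of_ne (by omega)] at hf'
      obtain ⟨g, hg, i', hi', hqi⟩ := h6 i hi f' hf'
      refine ⟨g, ?_, i', hi', by rw [Function.update_of_ne (by omega), hqi]⟩
      rw [Function.update_of_ne, hg]
      intro hr; rw [hr, hp] at hg; omega
    · rw [Function.update_self, hf3] at hf'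
      obtain rfl : f = f' := by omega
      exact ⟨e, by rw [hf2, Function.update_self], qh, hq,
        by rw [Function.update_of_ne (by omega), hqe]⟩
  · intro _ i hi
    rw [Function.update_of_ne (show i ≠ tail by omega), Function.update_of_ne]
    · exact h7 hfd i hi
    · intro hi'; have := h7 hfd i hi; rw [hi', hc] at this; omega
  · intro e' he' hm'
    obtain ⟨i, hi, hqi⟩ := h8 e' he' hm'
    exact ⟨i, by omega, by rw [Function.update_of_ne (by omega), hqi]⟩
  · intro g hg; omega
  · intro h0; exact absurd hfd h0
  · omega

/-- The credit that pays for the remaining iterations of the search at `K` steps each.  An arc yet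
to be scanned holds three units: one for its scan, one for the removal of the vertex that the scan
may append to the queue, and one that bounds the length of the queue by the credit spent. -/
def searchCredit (A : ArcList) (K : ℕ) (cur : ℕ → ℕ) (qh tail : ℕ) : ℕ :=
  ∑ e ∈ Finset.range A.m, (if e < cur (A.l e) then 3 * K else 0) + (tail - qh) * K

theorem searchCredit_le {K : ℕ} : A.searchCredit K cur qh tail ≤ (3 * A.m + tail) * K := by
  have h : ∑ e ∈ Finset.range A.m, (if e < cur (A.l e) then 3 * K else 0) ≤ A.m * (3 * K) :=
    (Finset.sum_le_card_nsmul _ _ (3 * K) fun e _ => by split_ifs <;> omega).trans (by simp)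
  have h' : (tail - qh) * K ≤ tail * K := Nat.mul_le_mul_right _ (by omega)
  rw [searchCredit, show (3 * A.m + tail) * K = A.m * (3 * K) + tail * K by ring]
  omega

theorem sum_pending_advance {K e : ℕ} (hA : A.Ok) (he : e < A.m) (hc : cur (A.l e) = e + 1) :
    ∑ f ∈ Finset.range A.m,
        (if f < Function.update cur (A.l e) (A.nx e) (A.l f) then 3 * K else 0) + 3 * K
      ≤ ∑ f ∈ Finset.range A.m, (if f < cur (A.l f) then 3 * K else 0) := by
  have := hA.nx_le e he
  refine sum_add_le_sum_of_le_of_add_le (fun f _ => ?_) (Finset.mem_range.2 he) ?_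
  · by_cases h : A.l f = A.l e
    · simp only [h, Function.update_self, hc]
      split_ifs <;> omega
    · simp [Function.update_of_ne h]
  · simp only [Function.update_self, hc]
    split_ifs <;> omega

theorem searchCredit_next {K : ℕ} (h : qh < tail) :
    A.searchCredit K cur (qh + 1) tail + K ≤ A.searchCredit K cur qh tail := by
  have : (tail - qh) * K = (tail - (qh + 1)) * K + K := by
    rw [← Nat.succ_mul]; congr 1; omega
  simp only [searchCredit]
  omega

theorem searchCredit_advance {K e : ℕ} (hA : A.Ok) (he : e < A.m) (hc : cur (A.l e) = e + 1) :
    A.searchCredit K (Function.update cur (A.l e) (A.nx e)) qh tail + K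
      ≤ A.searchCredit K cur qh tail := by
  have := sum_pending_advance (K := K) hA he hc
  simp only [searchCredit]
  omega

theorem searchCredit_found {K e : ℕ} (hA : A.Ok) (he : e < A.m) (hc : cur (A.l e) = e + 1) :
    A.searchCredit K (Function.update cur (A.l e) (A.nx e)) tail tail + K
      ≤ A.searchCredit K cur qh tail := by
  have := sum_pending_advance (K := K) hA he hc
  simp only [searchCredit, Nat.sub_self, Nat.zero_mul]
  omega

theorem searchCredit_push {K e : ℕ} (hA : A.Ok) (he : e < A.m) (hc : cur (A.l e) = e + 1)
    (h : qh ≤ tail) :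
    A.searchCredit K (Function.update cur (A.l e) (A.nx e)) qh (tail + 1) + 2 * K
      ≤ A.searchCredit K cur qh tail := by
  have := sum_pending_advance (K := K) hA he hc
  have : (tail + 1 - qh) * K = (tail - qh) * K + K := by
    rw [← Nat.succ_mul]; congr 1; omega
  simp only [searchCredit]
  omega

/-- The outcome of a search that reaches no free right vertex.  The left vertices `u` with
`cur u ≠ 0` and the right vertices `v` with `par v ≠ 0` cover all alive arcs (`closed`), and each
of them is matched, no two by the same arc (`left`, `right`). -/
structure Optimal (A : ArcList) (dd ml mr cur par : ℕ → ℕ) : Prop where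
  cons : A.Consistent dd ml mr ∅
  closed : ∀ e < A.m, dd e = 0 → cur (A.l e) = 0 → par (A.r e) ≠ 0
  left : ∀ e < A.m, cur (A.l e) ≠ 0 → ml (A.l e) ≠ 0
  right : ∀ e < A.m, par (A.r e) ≠ 0 → ∃ f, mr (A.r e) = f + 1 ∧ cur (A.l f) = 0

theorem Search.optimal (hcons : A.Consistent dd ml mr ∅)
    (h : A.Search dd ml mr cur par q tail tail 0) : A.Optimal dd ml mr cur par where
  cons := hcons
  closed e he hd hc := h.closed e he hd (by omega)
  left e he hc hm := by
    obtain ⟨i, hi, hq⟩ := h.roots e he hm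
    exact hc (hq ▸ h.finished rfl i hi)
  right e he hp := by
    obtain ⟨f, hf, i, hi, hq⟩ := h.visited rfl e he hp
    exact ⟨f, hf, hq ▸ h.finished rfl i hi⟩

/-! ### Augmenting the matching -/

/-- The invariant of the walk back along an augmenting path.  The arc with link `g` is to be matched
next; its right end is free, while all other vertices are matched consistently by `N` arcs.  Its
left end is in the queue before position `T`, and up to that position the matching is still the one
that the search used, so that the walk moves towards the front of the queue. -/
structure Augmenting (A : ArcList) (dd ml mr par q : ℕ → ℕ) (N g T : ℕ) : Prop where
  cons : ∀ e, g = e + 1 → e < A.m ∧ dd e = 0 ∧ A.Consistent dd ml mr {A.r e} ∧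
    (A.matched ml).card = N ∧ ∃ i < T, q i = A.l e
  done : g = 0 → A.Consistent dd ml mr ∅ ∧ (A.matched ml).card = N + 1
  queue_parent : ∀ i < T, ∀ f, ml (q i) = f + 1 →
    ∃ g, par (A.r f) = g + 1 ∧ ∃ i' < i, q i' = A.l g

variable {N T : ℕ}

theorem Search.augmenting (hcons : A.Consistent dd ml mr ∅)
    (h : A.Search dd ml mr cur par q qh tail fd) (hfd : fd ≠ 0) :
    A.Augmenting dd ml mr par q (A.matched ml).card fd tail where
  cons e he := by
    obtain ⟨h1, h2, h3, h4⟩ := h.found e he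
    exact ⟨h1, h2, hcons.weaken ⟨e, h1, rfl⟩ h3, rfl, h4⟩
  done h0 := absurd h0 hfd
  queue_parent := h.queue_parent

theorem Augmenting.last {e : ℕ} (h : A.Augmenting dd ml mr par q N (e + 1) T)
    (hm : ml (A.l e) = 0) :
    A.Augmenting dd (Function.update ml (A.l e) (e + 1)) (Function.update mr (A.r e) (e + 1))
      par q N 0 0 := by
  obtain ⟨he, hd, hc, hN, -⟩ := h.cons e rfl
  exact ⟨fun e he => by omega, fun _ => ⟨hc.match_free he hd hm,
    by rw [card_matched_update_free he hm, hN]⟩, fun i hi => by omega⟩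

theorem Augmenting.step {e f : ℕ} (h : A.Augmenting dd ml mr par q N (e + 1) T)
    (hpar : ∀ e < A.m, ∀ g, par (A.r e) = g + 1 → g < A.m ∧ A.r g = A.r e ∧ dd g = 0)
    (hm : ml (A.l e) = f + 1) :
    ∃ T' < T, par (A.r f) ≠ 0 ∧ A.Augmenting dd (Function.update ml (A.l e) (e + 1))
      (Function.update mr (A.r e) (e + 1)) par q N (par (A.r f)) T' := by
  classical
  obtain ⟨he, hd, hc, hN, hex⟩ := h.cons e rfl
  have hf := (hc.left e he f hm).1
  -- The first position of `l e` in the queue: before it the matching does not change.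
  obtain ⟨hiT, hqi⟩ := Nat.find_spec hex
  have hmin := fun j (hj : j < Nat.find hex) => Nat.find_min hex hj
  set i := Nat.find hex
  obtain ⟨g, hg, hi'⟩ := h.queue_parent i hiT f (by rw [hqi, hm])
  obtain ⟨hg1, hg2, hg3⟩ := hpar f hf g hg
  refine ⟨i, hiT, by omega, fun e' he' => ?_, fun h0 => by omega, fun j hj f' hf' => ?_⟩
  · obtain rfl : g = e' := by omega
    refine ⟨hg1, hg3, ?_, ?_, hi'⟩
    · rw [hg2]; exact hc.rematch he hd hm
    · rw [hc.card_matched_update he hm rfl, hN]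
  · have hne : q j ≠ A.l e := fun hq => hmin j hj ⟨by omega, hq⟩
    rw [Function.update_of_ne hne] at hf'
    exact h.queue_parent j (by omega) f' hf'

end ArcList

open RAM.Expr (var lit get succ pred)
open RAM.Test (eq lt)

attribute [local simp] WP_seq WP_assign WP_store WP_ite WP_skip Expr.eval Expr.cost Test.Holds
  Test.cost

/-! ### The matching programs -/

/-!
The programs use the following registers and arrays, besides those of the input.

* Register `3`: number of arcs; `4`: level bound; `5`: index of the round; `6`: index of the inner
  `for` loops; `7`, `8`, `9`: current vertex, arc and link; `10`: whether there is a bidder; `11`: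
  whether to go on augmenting; `12`, `13`: head and tail of the queue; `14`: link of the arc found.
* Arrays `3`, `4`: left and right ends of the arcs; `5`, `6`: heads and successors of the linked
  lists; `7`: dead arcs; `8`, `9`: matching; `10`: prices; `11`: levels; `12`: scan pointers; `13`:
  search tree; `14`: queue; `15`: colours.
-/

/-- The data that stay fixed while a matching is computed: register `3` holds the number of arcs
and register `4` the level bound `L`, arrays `3` to `6` hold the arc list, and array `7` marks the
dead arcs. -/
structure Env (A : ArcList) (L : ℕ) (dd : ℕ → ℕ) (σ : State) : Prop where
  m : σ.reg 3 = A.m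
  L : σ.reg 4 = L
  l : σ.arr 3 = A.l
  r : σ.arr 4 = A.r
  hd : σ.arr 5 = A.hd
  nx : σ.arr 6 = A.nx
  dd : σ.arr 7 = dd

variable {A : ArcList} {L : ℕ} {dd : ℕ → ℕ} {σ τ : State}

theorem Env.setR (h : Env A L dd σ) {x v : ℕ} (hx : 3 ≠ x ∧ 4 ≠ x := by decide) :
    Env A L dd (σ.setR x v) := by
  obtain ⟨h1, h2, h3, h4, h5, h6, h7⟩ := h
  constructor <;> simp [*]

theorem Env.setA (h : Env A L dd σ) {a i v : ℕ}
    (ha : 3 ≠ a ∧ 4 ≠ a ∧ 5 ≠ a ∧ 6 ≠ a ∧ 7 ≠ a := by decide) : Env A L dd (σ.setA a i v) := by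
  obtain ⟨h1, h2, h3, h4, h5, h6, h7⟩ := h
  constructor <;> simp [*]

/-- To establish a weakest precondition, it suffices to establish it for an arbitrary
postcondition implied by the given one.  With an opaque postcondition, `simp` can execute a program
symbolically without unfolding the assertion to be proved about the final state. -/
theorem WP.of_forall {p : Program} {Q : State → ℕ → Prop}
    (h : ∀ Q' : State → ℕ → Prop, (∀ τ t, Q τ t → Q' τ t) → WP p σ Q') : WP p σ Q :=
  h Q fun _ _ h => h

/-- The matching arrays `8`, `9`, the prices `10`, the levels `11` and the scan pointers `12` are
reset at the ends of all arcs. -/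
def auctionReset : Program :=
  forLoop 6 3 <|
    .seq (.store 8 (get 3 (var 6)) (lit 0)) <|
    .seq (.store 9 (get 4 (var 6)) (lit 0)) <|
    .seq (.store 10 (get 4 (var 6)) (lit 0)) <|
    .seq (.store 11 (get 3 (var 6)) (lit 0)) <|
    .store 12 (get 3 (var 6)) (get 5 (get 3 (var 6)))

/-- The left vertex in register `7` is matched by the arc in register `8`; if the right end was
matched before, its former partner becomes the new bidder. -/
def auctionBid : Program :=
  .seq (.store 10 (get 4 (var 8)) (succ (get 10 (get 4 (var 8))))) <|
  .seq (.assign 9 (get 9 (get 4 (var 8)))) <|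
  .seq (.store 9 (get 4 (var 8)) (succ (var 8))) <|
  .seq (.store 8 (var 7) (succ (var 8))) <|
  .ite (eq (var 9) (lit 0)) (.assign 10 (lit 0)) <|
    .seq (.assign 7 (get 3 (pred (var 9)))) (.store 8 (var 7) (lit 0))

/-- One step of the bidder in register `7`: it scans one arc, or rises by one level.  Register `10`
becomes `0` when no bidder is left. -/
def auctionStep : Program :=
  .seq (.assign 8 (get 12 (var 7))) <|
  .ite (eq (var 8) (lit 0))
    (.seq (.store 11 (var 7) (succ (get 11 (var 7)))) <|
     .seq (.store 12 (var 7) (get 5 (var 7))) <|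
     .ite (lt (var 4) (get 11 (var 7))) (.assign 10 (lit 0)) .skip)
    (.seq (.assign 8 (pred (var 8))) <|
     .seq (.store 12 (var 7) (get 6 (var 8))) <|
     .ite (eq (get 7 (var 8)) (lit 0))
      (.ite (eq (get 10 (get 4 (var 8))) (get 11 (var 7))) auctionBid .skip)
      .skip)

/-- Each free left vertex of level at most `L` bids in turn. -/
def auction : Program :=
  .seq (.assign 10 (lit 0)) <|
  forLoop 6 3 <|
    .seq (.assign 7 (get 3 (var 6))) <|
    .ite (eq (get 8 (var 7)) (lit 0))
      (.ite (lt (get 11 (var 7)) (succ (var 4)))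
        (.seq (.assign 10 (lit 1)) (.loop (eq (var 10) (lit 1)) auctionStep))
        .skip)
      .skip

/-- The invariant of the bidding: register `10` tells whether register `7` holds a bidder, and
among the left ends of the first `j` arcs the free ones other than the bidder have reached level
`L + 1`. -/
structure AuctionState (A : ArcList) (L : ℕ) (dd : ℕ → ℕ) (j : ℕ) (σ : State) : Prop where
  env : Env A L dd σ
  auction : A.Auction L dd (σ.arr 8) (σ.arr 9) (σ.arr 10) (σ.arr 11) (σ.arr 12)
  bidder : σ.reg 10 = 1 → (∃ e < A.m, A.l e = σ.reg 7) ∧ σ.arr 8 (σ.reg 7) = 0 ∧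
    σ.arr 11 (σ.reg 7) ≤ L
  settled : ∀ e < A.m, e < j → σ.arr 8 (A.l e) = 0 →
    σ.arr 11 (A.l e) = L + 1 ∨ σ.reg 10 = 1 ∧ A.l e = σ.reg 7

/-- One iteration of the auction takes at most `60` steps and `3` for the loop test, which the
credit pays for. -/
theorem AuctionState.step (hA : A.Ok) {j : ℕ} (h : AuctionState A L dd j σ) (hb : σ.reg 10 = 1) :
    WP auctionStep σ fun τ t => AuctionState A L dd j τ ∧ t ≤ 60 ∧
      A.auctionCredit L 63 (τ.arr 11) (τ.arr 12) + 63 ≤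
        A.auctionCredit L 63 (σ.arr 11) (σ.arr 12) := by
  obtain ⟨henv, hau, hbid, hset⟩ := h
  obtain ⟨hx, hfree, hlev⟩ := hbid hb
  refine WP.of_forall fun Q hQ => ?_
  rcases hc : σ.arr 12 (σ.reg 7) with _ | e
  · have hau' := hau.bump hA hfree hc hlev
    have hcr := A.auctionCredit_bump (K := 63) hx hc hlev
    rw [← henv.hd] at hau' hcr
    simp [auctionStep, hc, henv.L]
    refine ⟨fun hL => hQ _ _ ⟨⟨?_, ?_, ?_, fun e he hej hfe => ?_⟩, ?_, ?_⟩,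
      fun hL => hQ _ _ ⟨⟨?_, ?_, fun _ => ⟨?_, ?_, ?_⟩, fun e he hej hfe => ?_⟩, ?_, ?_⟩⟩
    · exact (((henv.setR).setA).setA).setR
    · simpa using hau'
    · simp
    · simp at hfe
      have := hset e he hej hfe
      simp [Function.update_apply]
      grind
    · norm_num
    · simpa using hcr
    · exact ((henv.setR).setA).setA
    · simpa using hau'
    · simpa using hx
    · simpa using hfree
    · simpa using hL
    · simp at hfe
      have := hset e he hej hfe
      simp [Function.update_apply, hb]
      grind
    · norm_num
    · simpa using hcr
  · obtain ⟨x, hx, hxe⟩ := hx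
    obtain ⟨he, hle⟩ := hau.ptr x hx e (by rw [hxe, hc])
    rw [hxe] at hle
    rw [← hle] at hc hlev hfree
    have hcr := A.auctionCredit_advance (K := 63) (L := L) (lev := σ.arr 11) hA he hc
    by_cases hbidding : dd e = 0 ∧ σ.arr 10 (A.r e) = σ.arr 11 (A.l e)
    · obtain ⟨hd, hp⟩ := hbidding
      rcases hm : σ.arr 9 (A.r e) with _ | f
      · have hau' := hau.bid_free hA he hc hd hp hfree hm
        simp [auctionStep, auctionBid, ← hle, hc, henv.L, henv.dd, henv.r, henv.nx, hd, hp, hm]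
        refine hQ _ _ ⟨⟨?_, ?_, ?_, fun e' he' hej hfe => ?_⟩, ?_, ?_⟩
        · exact (((((((henv.setR).setR).setA).setA).setR).setA).setA).setR
        · simpa [hp] using hau'
        · simp
        · simp [Function.update_apply] at hfe ⊢
          have := hset e' he' hej
          grind
        · norm_num
        · simpa using hcr
      · have hau' := hau.bid_matched hA he hc hd hp hfree hm
        obtain ⟨hf, hfr, hfl⟩ := hau.cons.right e he f (by simp) hm
        have hpf := hau.price_matched f hf hfl
        simp [auctionStep, auctionBid, ← hle, hc, henv.L, henv.dd, henv.r, henv.nx, hd, hp, hm,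
          henv.l]
        refine hQ _ _ ⟨⟨?_, ?_, fun _ => ⟨⟨f, hf, ?_⟩, ?_, ?_⟩, fun e' he' hej hfe => ?_⟩, ?_, ?_⟩
        · exact ((((((((henv.setR).setR).setA).setA).setR).setA).setA).setR).setA
        · simpa [hp] using hau'
        · simp
        · simp
        · simp
          rw [hfr] at hpf
          omega
        · simp [Function.update_apply, hb] at hfe ⊢
          have := hset e' he' hej
          grind
        · norm_num
        · simpa using hcr
    · have hau' := hau.advance hA he hc (fun hd => by
        have := hau.lev_le_price e he hd
        rcases this.lt_or_eq with h | h
        · exact h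
        · exact absurd ⟨hd, h.symm⟩ hbidding)
      simp [auctionStep, ← hle, hc, henv.L, henv.dd, henv.r, henv.nx]
      have key : ∀ t ≤ 60, Q ((((σ.setR 8 (e + 1)).setR 8 e).setA 12 (A.l e) (A.nx e))) t := by
        refine fun t ht => hQ _ _ ⟨⟨?_, ?_, fun _ => ⟨⟨e, he, ?_⟩, ?_, ?_⟩,
          fun e' he' hej hfe => ?_⟩, ht, ?_⟩
        · exact ((henv.setR).setR).setA
        · simpa using hau'
        · simpa using hle
        · simpa [← hle] using hfree
        · simpa [← hle] using hlev
        · simp at hfe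
          simpa using hset e' he' hej hfe
        · simpa using hcr
      refine ⟨fun hd => ⟨fun hp => absurd ⟨hd, hp⟩ hbidding, fun _ => key _ (by norm_num)⟩,
        fun _ => key _ (by norm_num)⟩

theorem auctionReset_spec (henv : Env A L dd σ) :
    WP auctionReset σ fun τ t => Env A L dd τ ∧ (∀ e < A.m, τ.arr 8 (A.l e) = 0 ∧
      τ.arr 9 (A.r e) = 0 ∧ τ.arr 10 (A.r e) = 0 ∧ τ.arr 11 (A.l e) = 0 ∧
      τ.arr 12 (A.l e) = A.hd (A.l e)) ∧ t ≤ A.m * 40 + 5 := by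
  refine (WP_forLoop (by decide) (by decide) (by decide) (c := 34)
    (fun i τ φ => Env A L dd τ ∧ φ = 0 ∧ ∀ e < i, τ.arr 8 (A.l e) = 0 ∧
      τ.arr 9 (A.r e) = 0 ∧ τ.arr 10 (A.r e) = 0 ∧ τ.arr 11 (A.l e) = 0 ∧
      τ.arr 12 (A.l e) = A.hd (A.l e)) ?_ henv.m (φ := 0) ⟨henv.setR, rfl, by simp⟩).mono ?_
  · rintro i hi τ φ ⟨hτ, rfl, h⟩ hj
    simp [hj, hτ.l, hτ.r, hτ.hd]
    refine ⟨(((((hτ.setA).setA).setA).setA).setA).setR, fun e he => ?_⟩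
    simp only [Function.update_apply]
    rcases he.lt_or_eq with he | rfl
    · have := h e he
      grind
    · simp
  · rintro τ t ⟨φ, ⟨h1, rfl, h2⟩, ht⟩
    exact ⟨h1, h2, by omega⟩

theorem auction_spec (hA : A.Ok) (henv : Env A L dd σ) (h : ∀ e < A.m, σ.arr 8 (A.l e) = 0 ∧
      σ.arr 9 (A.r e) = 0 ∧ σ.arr 10 (A.r e) = 0 ∧ σ.arr 11 (A.l e) = 0 ∧
      σ.arr 12 (A.l e) = A.hd (A.l e)) :
    WP auction σ fun τ t => Env A L dd τ ∧
      A.Auction L dd (τ.arr 8) (τ.arr 9) (τ.arr 10) (τ.arr 11) (τ.arr 12) ∧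
      (∀ e < A.m, τ.arr 8 (A.l e) = 0 → τ.arr 11 (A.l e) = L + 1) ∧
      t ≤ A.m * (L + 2) * 150 + 10 := by
  rw [auction, WP_seq, WP_assign]
  refine (WP_forLoop (by decide) (by decide) (by decide) (c := 34)
    (fun i τ φ => AuctionState A L dd i τ ∧ τ.reg 10 ≠ 1 ∧
      φ = A.auctionCredit L 63 (τ.arr 11) (τ.arr 12)) ?_ (by simpa using henv.m)
      ⟨⟨(henv.setR).setR, ?_, by simp, by simp⟩, by simp, rfl⟩).mono ?_
  · rintro j hj τ φ ⟨⟨henv, hau, -, hset⟩, hb, rfl⟩ hτj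
    -- The left end of arc `j` is settled if it does not bid.
    have key : (τ.arr 8 (A.l j) = 0 → ¬ τ.arr 11 (A.l j) < L + 1) → ∀ t ≤ 34,
        ∃ φ', (AuctionState A L dd (j + 1) ((τ.setR 7 (A.l j)).setR 6 (j + 1)) ∧
          ((τ.setR 7 (A.l j)).setR 6 (j + 1)).reg 10 ≠ 1 ∧
          φ' = A.auctionCredit L 63 (((τ.setR 7 (A.l j)).setR 6 (j + 1)).arr 11)
            (((τ.setR 7 (A.l j)).setR 6 (j + 1)).arr 12)) ∧
          t + φ' ≤ A.auctionCredit L 63 (τ.arr 11) (τ.arr 12) + 34 := by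
      intro hn t ht
      refine ⟨_, ⟨⟨(henv.setR).setR, by simpa using hau, by simp [hb], ?_⟩, by simpa using hb, rfl⟩,
        by simp; omega⟩
      intro e he hej hfe
      simp at hfe ⊢
      left
      rcases Nat.lt_succ_iff_lt_or_eq.1 hej with hej | rfl
      · have := hset e he hej hfe
        simpa [hb] using this
      · have := hau.lev_le e he
        have := hn hfe
        omega
    simp only [WP_seq, WP_assign, WP_ite, WP_skip, Test.Holds, Expr.eval, hτj, henv.l,
      State.setR_arr, State.setR_reg, henv.L, if_true]
    refine ⟨fun hfree =>
        ⟨fun hlev => ?_, fun hlev => key (fun _ => by simpa using hlev) _ (by simp)⟩,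
      fun hfree => key (fun h0 => absurd h0 hfree) _ (by simp)⟩
    simp at hlev
    refine (WP_loop (fun υ ψ => AuctionState A L dd (j + 1) υ ∧
      ψ = A.auctionCredit L 63 (υ.arr 11) (υ.arr 12)) ?_ ⟨⟨?_, ?_, ?_, ?_⟩, rfl⟩).mono ?_
    · rintro υ ψ ⟨hυ, rfl⟩ hb
      refine (hυ.step hA hb).mono ?_
      rintro υ' t ⟨h1, h2, h3⟩
      refine ⟨_, ⟨h1, rfl⟩, ?_⟩
      simp
      omega
    · exact (henv.setR).setR
    · simpa using hau
    · intro _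
      exact ⟨⟨j, hj, by simp⟩, by simpa using hfree, by simp; omega⟩
    · intro e he hej hfe
      simp at hfe ⊢
      rcases Nat.lt_succ_iff_lt_or_eq.1 hej with hej | rfl
      · have := hset e he hej hfe
        simp [hb] at this
        exact Or.inl this
      · exact Or.inr rfl
    · rintro υ t ⟨hn, φ', ⟨hυ, rfl⟩, ht⟩
      obtain ⟨h1, h2, h3, h4⟩ := hυ
      simp at hn
      refine ⟨_, ⟨⟨h1.setR, by simpa using h2, by simp [hn], ?_⟩, by simpa using hn, rfl⟩, ?_⟩
      · simpa [hn] using h4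
      · simp at ht ⊢
        omega
  · simpa using ArcList.Auction.init hA h
  · rintro τ t ⟨φ, ⟨⟨h1, h2, -, h3⟩, hb, rfl⟩, ht⟩
    refine ⟨h1, h2, fun e he hfe => ?_, ?_⟩
    · simpa [hb] using h3 e he he hfe
    · simp at ht
      have h5 := A.auctionCredit_le (L := L) (K := 63) (lev := σ.arr 11) (cur := σ.arr 12)
      simp
      nlinarith

/-- The matching `8`, `9` is prepared for a search: the scan pointers `12` and the search tree `13`
are reset, and the queue `14` between the positions in registers `12` and `13` receives the free
left vertices.  Register `14` is the link of the arc found by the search. -/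
def searchReset : Program :=
  .seq (.assign 12 (lit 0)) <|
  .seq (.assign 13 (lit 0)) <|
  .seq (.assign 14 (lit 0)) <|
  .seq (forLoop 6 3 <|
    .seq (.store 12 (get 3 (var 6)) (get 5 (get 3 (var 6)))) <|
    .store 13 (get 4 (var 6)) (lit 0)) <|
  forLoop 6 3 <|
    .ite (eq (get 8 (get 3 (var 6))) (lit 0))
      (.seq (.store 14 (var 13) (get 3 (var 6))) <|
       .assign 13 (succ (var 13)))
      .skip

/-- One step of the search: the first vertex in the queue scans one arc or leaves the queue. -/
def searchStep : Program :=
  .seq (.assign 7 (get 14 (var 12))) <|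
  .seq (.assign 8 (get 12 (var 7))) <|
  .ite (eq (var 8) (lit 0))
    (.assign 12 (succ (var 12)))
    (.seq (.assign 8 (pred (var 8))) <|
     .seq (.store 12 (var 7) (get 6 (var 8))) <|
     .ite (eq (get 7 (var 8)) (lit 0))
      (.ite (eq (get 13 (get 4 (var 8))) (lit 0))
        (.seq (.store 13 (get 4 (var 8)) (succ (var 8))) <|
         .seq (.assign 9 (get 9 (get 4 (var 8)))) <|
         .ite (eq (var 9) (lit 0))
          (.seq (.assign 14 (succ (var 8))) (.assign 12 (var 13)))
          (.seq (.store 14 (var 13) (get 3 (pred (var 9)))) <|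
           .assign 13 (succ (var 13))))
        .skip)
      .skip)

/-- A search from all free left vertices. -/
def search : Program := .seq searchReset (.loop (lt (var 12) (var 13)) searchStep)

/-- One step of the augmentation: the arc with the link in register `14` is matched. -/
def augmentStep : Program :=
  .seq (.assign 8 (pred (var 14))) <|
  .seq (.assign 9 (get 8 (get 3 (var 8)))) <|
  .seq (.store 8 (get 3 (var 8)) (var 14)) <|
  .seq (.store 9 (get 4 (var 8)) (var 14)) <|
  .ite (eq (var 9) (lit 0))
    (.assign 14 (lit 0))
    (.assign 14 (get 13 (get 4 (pred (var 9)))))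

/-- Augment the matching until no augmenting path is found. -/
def augmentAll : Program :=
  .seq (.assign 11 (lit 1)) <|
  .loop (eq (var 11) (lit 1)) <|
    .seq search <|
    .ite (eq (var 14) (lit 0))
      (.assign 11 (lit 0))
      (.loop (lt (lit 0) (var 14)) augmentStep)

/-- The invariant of the search, for the arrays and registers of the program. -/
structure SearchState (A : ArcList) (L : ℕ) (dd ml mr : ℕ → ℕ) (σ : State) : Prop where
  env : Env A L dd σ
  arr_ml : σ.arr 8 = ml
  arr_mr : σ.arr 9 = mr
  search : A.Search dd ml mr (σ.arr 12) (σ.arr 13) (σ.arr 14) (σ.reg 12) (σ.reg 13) (σ.reg 14)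

/-- The credit left in a state of the search. -/
def State.searchCredit (σ : State) (A : ArcList) : ℕ :=
  A.searchCredit 63 (σ.arr 12) (σ.reg 12) (σ.reg 13)

variable {ml mr : ℕ → ℕ}

/-- One iteration of the search takes at most `60` steps and `3` for the loop test.  The last
inequality bounds the length of the queue at the end of the search. -/
theorem SearchState.step (hA : A.Ok) (hcons : A.Consistent dd ml mr ∅)
    (h : SearchState A L dd ml mr σ) (hq : σ.reg 12 < σ.reg 13) :
    WP searchStep σ fun τ t => SearchState A L dd ml mr τ ∧ t ≤ 60 ∧
      τ.searchCredit A + 63 ≤ σ.searchCredit A ∧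
      τ.searchCredit A + 63 * τ.reg 13 ≤ σ.searchCredit A + 63 * σ.reg 13 := by
  obtain ⟨henv, hml, hmr, hs⟩ := h
  obtain ⟨x, hx, hqx⟩ := hs.queue_mem _ hq
  simp only [State.searchCredit]
  refine WP.of_forall fun Q hQ => ?_
  rcases hc : σ.arr 12 (σ.arr 14 (σ.reg 12)) with _ | e
  · have hs' := hs.next hq hc
    have hcr := A.searchCredit_next (K := 63) (cur := σ.arr 12) hq
    simp [searchStep, hc]
    refine hQ _ _ ⟨⟨?_, ?_, ?_, ?_⟩, ?_, ?_, ?_⟩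
    · exact ((henv.setR).setR).setR
    · simpa using hml
    · simpa using hmr
    · simpa using hs'
    · norm_num
    · simpa using hcr
    · simp; omega
  · obtain ⟨he, hle⟩ := hs.ptr x hx e (by rw [← hqx, hc])
    rw [← hqx] at hle
    have hqe := hle.symm
    rw [hqe] at hc
    by_cases hv : dd e = 0 ∧ σ.arr 13 (A.r e) = 0
    · obtain ⟨hd, hp⟩ := hv
      rcases hm : mr (A.r e) with _ | f
      · have hs' := hs.visit_free hA hq he hqe hc hd hp hm
        have hcr := A.searchCredit_found (K := 63) (qh := σ.reg 12) (tail := σ.reg 13) hA he hc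
        simp [searchStep, hqe, hc, henv.dd, henv.r, henv.nx, hd, hp, hm, hmr]
        refine hQ _ _ ⟨⟨?_, ?_, ?_, ?_⟩, ?_, ?_, ?_⟩
        · exact ((((((((henv.setR).setR).setR).setA).setA).setR).setR).setR)
        · simpa using hml
        · simpa using hmr
        · simpa using hs'
        · norm_num
        · simpa using hcr
        · simp; omega
      · have hs' := hs.visit_matched hA hcons hq he hqe hc hd hp hm
        have hcr := A.searchCredit_push (K := 63) (qh := σ.reg 12) (tail := σ.reg 13) hA he hc
          hq.le
        simp [searchStep, hqe, hc, henv.dd, henv.r, henv.nx, henv.l, hd, hp, hm, hmr]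
        refine hQ _ _ ⟨⟨?_, ?_, ?_, ?_⟩, ?_, ?_, ?_⟩
        · exact ((((((((henv.setR).setR).setR).setA).setA).setR).setA).setR)
        · simpa using hml
        · simpa using hmr
        · simpa using hs'
        · norm_num
        · simp; omega
        · simp; omega
    · have hs' := hs.advance hA he hc (fun hd hp => hv ⟨hd, hp⟩)
      have hcr := A.searchCredit_advance (K := 63) (qh := σ.reg 12) (tail := σ.reg 13) hA he hc
      simp [searchStep, hqe, hc, henv.dd, henv.r, henv.nx]
      have key : ∀ t ≤ 60, Q ((((σ.setR 7 (A.l e)).setR 8 (e + 1)).setR 8 e).setA 12 (A.l e)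
          (A.nx e)) t := by
        refine fun t ht => hQ _ _ ⟨⟨?_, ?_, ?_, ?_⟩, ht, ?_, ?_⟩
        · exact (((henv.setR).setR).setR).setA
        · simpa using hml
        · simpa using hmr
        · simpa using hs'
        · simpa using hcr
        · simp; omega
      exact ⟨fun hd => ⟨fun hp => absurd ⟨hd, hp⟩ hv, fun _ => key _ (by norm_num)⟩,
        fun _ => key _ (by norm_num)⟩

theorem searchReset_spec (hA : A.Ok) (henv : Env A L dd σ) :
    WP searchReset σ fun τ t => SearchState A L dd (σ.arr 8) (σ.arr 9) τ ∧ τ.reg 13 ≤ A.m ∧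
      t ≤ A.m * 42 + 20 := by
  rw [searchReset]
  simp only [WP_seq, WP_assign]
  refine (WP_forLoop (by decide) (by decide) (by decide) (c := 16)
    (fun i τ φ => Env A L dd τ ∧ τ.arr 8 = σ.arr 8 ∧ τ.arr 9 = σ.arr 9 ∧ τ.reg 12 = 0 ∧
      τ.reg 13 = 0 ∧ τ.reg 14 = 0 ∧ φ = 0 ∧
      ∀ e < i, τ.arr 12 (A.l e) = A.hd (A.l e) ∧ τ.arr 13 (A.r e) = 0) ?_ (by simpa using henv.m)
      (φ := 0) ⟨(((henv.setR).setR).setR).setR, by simp⟩).mono ?_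
  · rintro i hi τ φ ⟨hτ, h8, h9, h12, h13, h14, rfl, h⟩ hj
    simp [hj, hτ.l, hτ.r, hτ.hd, h8, h9, h12, h13, h14]
    refine ⟨((hτ.setA).setA).setR, fun e he => ?_⟩
    simp only [Function.update_apply]
    rcases he.lt_or_eq with he | rfl
    · have := h e he
      grind
    · simp
  · rintro τ t ⟨φ, ⟨hτ, h8, h9, h12, h13, h14, rfl, h⟩, ht⟩
    refine (WP_forLoop (by decide) (by decide) (by decide) (c := 14)
      (fun i τ φ => Env A L dd τ ∧ τ.arr 8 = σ.arr 8 ∧ τ.arr 9 = σ.arr 9 ∧ τ.reg 12 = 0 ∧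
        τ.reg 14 = 0 ∧ φ = 0 ∧ τ.reg 13 ≤ i ∧
        (∀ e < A.m, τ.arr 12 (A.l e) = A.hd (A.l e) ∧ τ.arr 13 (A.r e) = 0) ∧
        (∀ i < τ.reg 13, ∃ e < A.m, τ.arr 14 i = A.l e ∧ σ.arr 8 (A.l e) = 0) ∧
        (∀ e < i, σ.arr 8 (A.l e) = 0 → ∃ i < τ.reg 13, τ.arr 14 i = A.l e)) ?_ hτ.m
      (φ := 0) ⟨hτ.setR, by simpa [h8, h9, h12, h13, h14] using h⟩).mono ?_
    · rintro j hj υ φ ⟨hυ, h8, h9, h12, h14, rfl, h13, h, hq, hr⟩ hυj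
      simp only [WP_ite, WP_seq, WP_assign, WP_store, WP_skip, Test.Holds, Expr.eval, hυj, hυ.l, h8]
      refine ⟨fun hfree => ⟨0, ⟨(((hυ.setA).setR).setR), ?_⟩, by simp⟩,
        fun hfree => ⟨0, ⟨hυ.setR, ?_⟩, by simp⟩⟩
      · simp [h8, h9, h12, h14]
        refine ⟨h13, h, fun i hi => ?_, fun e he hfe => ?_⟩
        · rcases hi.lt_or_eq with hi | rfl
          · rw [Function.update_of_ne (by omega)]
            exact hq i hi
          · exact ⟨j, hj, by simp, hfree⟩
        · rcases he.lt_or_eq with he | rfl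
          · obtain ⟨i, hi, hqi⟩ := hr e he hfe
            exact ⟨i, by omega, by rw [Function.update_of_ne (by omega), hqi]⟩
          · exact ⟨υ.reg 13, le_rfl, by simp⟩
      · simp [h8, h9, h12, h14]
        refine ⟨by omega, h, hq, fun e he hfe => ?_⟩
        rcases he.lt_or_eq with he | rfl
        · exact hr e he hfe
        · exact absurd hfe hfree
    · rintro υ s ⟨φ, ⟨hυ, h8, h9, h12, h14, rfl, h13, h, hq, hr⟩, hs⟩
      refine ⟨⟨hυ, h8, h9, ?_⟩, h13, ?_⟩
      · rw [h12, h14]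
        exact .init hA h hq hr
      · simp
        omega

theorem search_spec (hA : A.Ok) (henv : Env A L dd σ)
    (hcons : A.Consistent dd (σ.arr 8) (σ.arr 9) ∅) :
    WP search σ fun τ t => SearchState A L dd (σ.arr 8) (σ.arr 9) τ ∧ ¬ τ.reg 12 < τ.reg 13 ∧
      τ.reg 13 ≤ 5 * A.m ∧ t ≤ A.m * 300 + 30 := by
  rw [search, WP_seq]
  refine (searchReset_spec hA henv).mono ?_
  rintro τ t ⟨hτ, htail, ht⟩
  have hcr : τ.searchCredit A ≤ (3 * A.m + τ.reg 13) * 63 := A.searchCredit_le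
  refine (WP_loop (fun υ φ => SearchState A L dd (σ.arr 8) (σ.arr 9) υ ∧ φ = υ.searchCredit A ∧
    υ.searchCredit A + 63 * υ.reg 13 ≤ τ.searchCredit A + 63 * τ.reg 13) ?_
    ⟨hτ, rfl, le_rfl⟩).mono ?_
  · rintro υ φ ⟨hυ, rfl, hle⟩ hq
    refine (hυ.step hA hcons hq).mono ?_
    rintro υ' s ⟨h1, h2, h3, h4⟩
    exact ⟨_, ⟨h1, rfl, by omega⟩, by simp; omega⟩
  · rintro υ s ⟨hn, φ, ⟨hυ, rfl, hle⟩, hs⟩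
    refine ⟨hυ, hn, by omega, ?_⟩
    simp at hs
    omega

theorem augment_spec {qh : ℕ} (hcons : A.Consistent dd ml mr ∅)
    (henv : Env A L dd σ) (hml : σ.arr 8 = ml) (hmr : σ.arr 9 = mr)
    (hs : A.Search dd ml mr (σ.arr 12) (σ.arr 13) (σ.arr 14) qh (σ.reg 13) (σ.reg 14))
    (hfd : σ.reg 14 ≠ 0) :
    WP (.loop (lt (lit 0) (var 14)) augmentStep) σ fun τ t => Env A L dd τ ∧
      A.Consistent dd (τ.arr 8) (τ.arr 9) ∅ ∧
      (A.matched (τ.arr 8)).card = (A.matched ml).card + 1 ∧ t ≤ σ.reg 13 * 30 + 3 := by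
  have hpar := fun e he g hg => (hs.parent e he g hg)
  refine (WP_loop (fun υ φ => Env A L dd υ ∧ υ.arr 13 = σ.arr 13 ∧ ∃ T, φ = T * 30 ∧
    A.Augmenting dd (υ.arr 8) (υ.arr 9) (σ.arr 13) (σ.arr 14) (A.matched ml).card (υ.reg 14) T)
    ?_ ⟨henv, rfl, σ.reg 13, rfl, ?_⟩).mono ?_
  · rintro υ φ ⟨hυ, h13, T, rfl, hau⟩ hb
    simp at hb
    obtain ⟨e, he⟩ := Nat.exists_eq_succ_of_ne_zero hb.ne'
    rw [he, Nat.succ_eq_add_one] at hau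
    obtain ⟨-, -, -, -, i, hi, -⟩ := hau.cons e rfl
    rcases hm : υ.arr 8 (A.l e) with _ | f
    · have h := hau.last hm
      simp [augmentStep, he, hυ.l, hυ.r, hm]
      refine ⟨0, ⟨?_, h13, h⟩, by omega⟩
      exact ((((hυ.setR).setR).setA).setA).setR
    · obtain ⟨T', hT', hne, h⟩ := hau.step (fun e he g hg =>
        ⟨(hpar e he g hg).1, (hpar e he g hg).2.1, (hpar e he g hg).2.2.1⟩) hm
      simp [augmentStep, he, hυ.l, hυ.r, hm, h13]
      refine ⟨T', ⟨?_, h⟩, by omega⟩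
      exact ((((hυ.setR).setR).setA).setA).setR
  · have := hs.augmenting hcons hfd
    rwa [hml, hmr]
  · rintro υ t ⟨hn, φ, ⟨hυ, -, T, rfl, hau⟩, ht⟩
    simp at hn ht
    obtain ⟨h1, h2⟩ := hau.done hn
    exact ⟨hυ, h1, h2, by omega⟩

theorem augmentAll_spec (hA : A.Ok) (henv : Env A L dd σ)
    (hcons : A.Consistent dd (σ.arr 8) (σ.arr 9) ∅) {N : ℕ}
    (hN : ∀ ml mr, A.Consistent dd ml mr ∅ → (A.matched ml).card ≤ N) :
    WP augmentAll σ fun τ t => Env A L dd τ ∧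
      A.Optimal dd (τ.arr 8) (τ.arr 9) (τ.arr 12) (τ.arr 13) ∧
      t ≤ (N + 1 - (A.matched (σ.arr 8)).card) * (A.m * 450 + 50) + 10 := by
  rw [augmentAll, WP_seq, WP_assign]
  refine (WP_loop (fun υ φ => Env A L dd υ ∧ A.Consistent dd (υ.arr 8) (υ.arr 9) ∅ ∧
    (υ.reg 11 ≠ 1 → A.Optimal dd (υ.arr 8) (υ.arr 9) (υ.arr 12) (υ.arr 13)) ∧
    (υ.reg 11 = 1 → φ = (N + 1 - (A.matched (υ.arr 8)).card) * (A.m * 450 + 50))) ?_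
    ⟨henv.setR, hcons, by simp, fun _ => rfl⟩).mono ?_
  · rintro υ φ ⟨hυ, hc, -, hφ⟩ hb
    simp only [Test.Holds, Expr.eval] at hb
    obtain rfl := hφ hb
    have hle := hN _ _ hc
    have hdrop : (N + 1 - (A.matched (υ.arr 8)).card) * (A.m * 450 + 50) =
        (N + 1 - ((A.matched (υ.arr 8)).card + 1)) * (A.m * 450 + 50) + (A.m * 450 + 50) := by
      rw [← Nat.succ_mul]; congr 1; omega
    rw [WP_seq]
    refine (search_spec hA hυ hc).frame.mono ?_
    rintro υ' t ⟨⟨⟨he', hml, hmr, hs⟩, hq, htail, ht⟩, hfr, -⟩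
    have h11 : υ'.reg 11 = 1 := by rw [hfr 11 (by decide), hb]
    have hqh : υ'.reg 12 = υ'.reg 13 := le_antisymm hs.qh_le (not_lt.1 hq)
    rw [WP_ite]
    refine ⟨fun hfd => ?_, fun hfd => ?_⟩
    · simp at hfd
      rw [hqh, hfd] at hs
      rw [WP_assign]
      refine ⟨0, ⟨he'.setR, ?_, fun _ => ?_, by simp⟩, ?_⟩
      · simpa [hml, hmr] using hc
      · simpa [hml, hmr] using hs.optimal hc
      · simp; omega
    · simp at hfd
      refine (augment_spec hc he' hml hmr hs hfd).frame.mono ?_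
      rintro υ'' s ⟨⟨he'', hc'', hcard, hs⟩, hfr, -⟩
      have h11 : υ''.reg 11 = 1 := by rw [hfr 11 (by decide), h11]
      refine ⟨_, ⟨he'', hc'', fun h => absurd h11 h, fun _ => rfl⟩, ?_⟩
      rw [hcard]
      simp only [Test.cost, Expr.cost]
      omega
  · rintro υ t ⟨hn, φ, ⟨hυ, -, hopt, -⟩, ht⟩
    simp only [Test.Holds, Expr.eval] at hn
    refine ⟨hυ, hopt hn, ?_⟩
    simp at ht ⊢
    omega

/-- Compute a maximum matching of the alive arcs. -/
def maximumMatching : Program := .seq auctionReset <| .seq auction augmentAll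

/-- If the level bound `L` is about the square root of the matching number, the auction leaves at
most `L` augmentations. -/
theorem maximumMatching_spec (hA : A.Ok) (hm : 0 < A.m) (henv : Env A L dd σ)
    (hL : ∀ ml mr, A.Consistent dd ml mr ∅ → (A.matched ml).card ≤ (L + 1) * L) :
    WP maximumMatching σ fun τ t => Env A L dd τ ∧
      A.Optimal dd (τ.arr 8) (τ.arr 9) (τ.arr 12) (τ.arr 13) ∧ t ≤ A.m * (L + 2) * 1000 := by
  rw [maximumMatching, WP_seq]
  refine (auctionReset_spec henv).mono ?_
  rintro σ₁ t₁ ⟨h₁, hinit, ht₁⟩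
  rw [WP_seq]
  refine (auction_spec hA h₁ hinit).mono ?_
  rintro σ₂ t₂ ⟨h₂, hau, hfree, ht₂⟩
  set c := (A.matched (σ₂.arr 8)).card
  refine (augmentAll_spec hA h₂ hau.cons (N := c + L) fun ml mr h => ?_).mono ?_
  · have h3 := hau.card_le hfree h
    have h4 : c ≤ (L + 1) * L := hL _ _ hau.cons
    have h5 : (L + 1) * (A.matched ml).card ≤ (L + 1) * (c + L) := by nlinarith
    exact Nat.le_of_mul_le_mul_left h5 (by omega)
  · rintro σ₃ t₃ ⟨h₃, hopt, ht₃⟩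
    refine ⟨h₃, hopt, ?_⟩
    rw [show c + L + 1 - c = L + 1 by omega] at ht₃
    nlinarith

/-! ### Building the arc lists -/

/-- Prepend a new arc from `u` to `v` to the list of `u`. -/
def ArcList.snoc (A : ArcList) (u v : ℕ) : ArcList where
  m := A.m + 1
  l := Function.update A.l A.m u
  r := Function.update A.r A.m v
  hd := Function.update A.hd u (A.m + 1)
  nx := Function.update A.nx A.m (A.hd u)

theorem ArcList.Ok.snoc {A : ArcList} (h : A.Ok) (u v : ℕ) : (A.snoc u v).Ok := by
  obtain ⟨h1, h2, h3, h4, h5⟩ := h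
  simp only [ArcList.Ptr] at h2 h3
  constructor
  · simp only [ArcList.snoc, Function.update_apply]; grind
  · intro w e he
    simp only [ArcList.snoc, Function.update_apply] at he ⊢
    split_ifs at he with hw
    · obtain rfl : A.m = e := by omega
      simp [hw]
    · obtain ⟨h, h'⟩ := h2 w e he
      rw [if_neg (by omega)]
      exact ⟨by omega, h'⟩
  · simp only [ArcList.snoc, ArcList.Ptr, Function.update_apply]; grind
  · simp only [ArcList.snoc, Function.update_apply]
    intro e he
    split_ifs with hem
    · by_contra hlt
      obtain ⟨c, hc⟩ := Nat.exists_eq_succ_of_ne_zero (n := A.hd u) (by omega)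
      have := (h2 u c hc).1
      omega
    · exact h4 e (by omega)
  · simp only [ArcList.snoc, Function.update_apply]; grind

/-- The arc list stored in a state. -/
def State.arcs (σ : State) : ArcList := ⟨σ.reg 3, σ.arr 3, σ.arr 4, σ.arr 5, σ.arr 6⟩

/-- Add the arc from entry `6` of array `a` to that of array `b`, where `6` is a register. -/
def addArc (a b : ℕ) : Program :=
  .seq (.store 3 (var 3) (get a (var 6))) <|
  .seq (.store 4 (var 3) (get b (var 6))) <|
  .seq (.store 6 (var 3) (get 5 (get a (var 6)))) <|
  .seq (.assign 3 (succ (var 3))) <|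
  .store 5 (get a (var 6)) (var 3)

/-- Every edge contributes two arcs, one in each direction. -/
def buildArcs : Program :=
  .seq (.assign 3 (lit 0)) <|
  forLoop 6 1 <| .seq (addArc 0 1) (addArc 1 0)

/-- The arcs `2 i` and `2 i + 1` join the ends `a i` and `b i` of edge `i < M` in both
directions. -/
structure ArcList.Doubles (A : ArcList) (M : ℕ) (a b : ℕ → ℕ) : Prop where
  ok : A.Ok
  m : A.m = 2 * M
  l_even : ∀ i < M, A.l (2 * i) = a i
  r_even : ∀ i < M, A.r (2 * i) = b i
  l_odd : ∀ i < M, A.l (2 * i + 1) = b i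
  r_odd : ∀ i < M, A.r (2 * i + 1) = a i

theorem ArcList.Doubles.snoc {A : ArcList} {M : ℕ} {a b : ℕ → ℕ} (h : A.Doubles M a b) :
    ((A.snoc (a M) (b M)).snoc (b M) (a M)).Doubles (M + 1) a b := by
  obtain ⟨h1, h2, h3, h4, h5, h6⟩ := h
  refine ⟨(h1.snoc _ _).snoc _ _, by simp [ArcList.snoc, h2]; ring, ?_, ?_, ?_, ?_⟩ <;>
    · intro i hi
      simp only [ArcList.snoc, Function.update_apply, h2]
      rcases Nat.lt_succ_iff_lt_or_eq.1 hi with hi | rfl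
      · have := h3 i hi
        have := h4 i hi
        have := h5 i hi
        have := h6 i hi
        rw [if_neg (by omega), if_neg (by omega)]
        assumption
      · grind

theorem addArc_spec {a b i : ℕ} (ha : a < 2) (hb : b < 2) (hi : σ.reg 6 = i) :
    WP (addArc a b) σ fun τ t => τ.arcs = σ.arcs.snoc (σ.arr a i) (σ.arr b i) ∧ t ≤ 30 := by
  have h1 : a ≠ 3 ∧ a ≠ 4 ∧ a ≠ 5 ∧ a ≠ 6 := by omega
  have h2 : b ≠ 3 ∧ b ≠ 4 ∧ b ≠ 5 ∧ b ≠ 6 := by omega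
  simp [addArc, h1, h2, hi, State.arcs, ArcList.snoc]

theorem buildArcs_spec {M : ℕ} (hM : σ.reg 1 = M) (h5 : σ.arr 5 = 0) :
    WP buildArcs σ fun τ t => τ.arcs.Doubles M (σ.arr 0) (σ.arr 1) ∧ t ≤ M * 70 + 10 := by
  rw [buildArcs, WP_seq, WP_assign]
  refine (WP_forLoop (by decide) (by decide) (by decide) (c := 60)
    (fun i τ φ => τ.arcs.Doubles i (σ.arr 0) (σ.arr 1) ∧ τ.arr 0 = σ.arr 0 ∧ τ.arr 1 = σ.arr 1 ∧
      φ = 0) ?_ (by simpa using hM) (φ := 0) ?_).mono ?_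
  · rintro i hi τ φ ⟨h, h0, h1, rfl⟩ hj
    rw [WP_seq]
    refine (addArc_spec (by norm_num) (by norm_num) hj).frame.mono ?_
    rintro τ₁ t₁ ⟨⟨h₁, ht₁⟩, hr₁, ha₁⟩
    refine (addArc_spec (i := i) (by norm_num) (by norm_num)
      (by rw [hr₁ 6 (by decide), hj])).frame.mono ?_
    rintro τ₂ t₂ ⟨⟨h₂, ht₂⟩, hr₂, ha₂⟩
    rw [ha₁ 0 (by decide), ha₁ 1 (by decide), h0, h1, h₁, h0, h1] at h₂
    refine ⟨0, ⟨?_, ?_, ?_, rfl⟩, by omega⟩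
    · have : (τ₂.setR 6 (i + 1)).arcs = τ₂.arcs := by simp [State.arcs]
      rw [this, h₂]
      exact h.snoc
    · simp [ha₂ 0 (by decide), ha₁ 0 (by decide), h0]
    · simp [ha₂ 1 (by decide), ha₁ 1 (by decide), h1]
  · refine ⟨⟨⟨?_, ?_, ?_, ?_, ?_⟩, ?_, ?_, ?_, ?_, ?_⟩, rfl, rfl, rfl⟩ <;>
      simp [State.arcs, ArcList.Ptr, h5]
  · rintro τ t ⟨φ, ⟨h, -, -, rfl⟩, ht⟩
    refine ⟨h, ?_⟩
    simp
    omega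

/-! ### Two-colouring -/

namespace ArcList

variable {A : ArcList} {χ : ℕ → Bool} {col cur q : ℕ → ℕ} {qh tail : ℕ}

/-- The invariant of the breadth-first search that finds a proper colouring with the colours `1`
and `2`, where `0` means uncoloured, given that some proper colouring `χ` exists.  The vertices
whose arcs have not all been scanned are coloured as by `χ`, up to a permutation of the colours
that depends on the component being searched. -/
structure Colouring (A : ArcList) (χ : ℕ → Bool) (col cur q : ℕ → ℕ) (qh tail : ℕ) : Prop where
  ptr : ∀ u, A.Ptr u (cur u)
  proper : ∀ e < A.m, cur (A.l e) ≤ e → col (A.r e) ≠ 0 ∧ col (A.l e) ≠ col (A.r e)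
  flip : ∃ f, ∀ u, col u ≠ 0 → cur u ≠ 0 → col u = if χ u = f then 1 else 2
  queue : ∀ u, col u ≠ 0 → cur u ≠ 0 → ∃ i, qh ≤ i ∧ i < tail ∧ q i = u
  queue_col : ∀ i, qh ≤ i → i < tail → col (q i) ≠ 0
  fresh : ∀ e < A.m, col (A.l e) = 0 → cur (A.l e) = A.hd (A.l e)
  qh_le : qh ≤ tail
  le_two : ∀ u, col u ≤ 2

theorem Colouring.init (hA : A.Ok) (hcur : ∀ e < A.m, cur (A.l e) = A.hd (A.l e))
    (hptr : ∀ u, A.Ptr u (cur u)) : A.Colouring χ (fun _ => 0) cur q 0 0 where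
  ptr := hptr
  proper e he hc := by have := hA.lt_hd e he; rw [hcur e he] at hc; omega
  flip := ⟨true, fun _ h => absurd rfl h⟩
  queue _ h := absurd rfl h
  queue_col i _ hi := by omega
  fresh e he _ := hcur e he
  qh_le := le_rfl
  le_two _ := Nat.zero_le _

/-- With an empty queue, the search of a new component starts at the vertex `v`. -/
theorem Colouring.seed (hA : A.Ok) (h : A.Colouring χ col cur q tail tail) {v : ℕ}
    (hv : col v = 0) :
    A.Colouring χ (Function.update col v 1) cur (Function.update q tail v) tail (tail + 1) := by
  obtain ⟨h1, h2, h3, h4, h5, h6, h7, hle⟩ := h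
  have h8 := hA.lt_hd
  have hcur : ∀ u, col u ≠ 0 → cur u = 0 := fun u hu => by
    by_contra hc; obtain ⟨i, hi, hi', -⟩ := h4 u hu hc; omega
  refine ⟨h1, ?_, ⟨χ v, ?_⟩, ?_, ?_, ?_, by omega, fun u => ?_⟩
  · simp only [Function.update_apply]; grind
  · simp only [Function.update_apply]; grind
  · intro u hu hc
    rcases eq_or_ne u v with rfl | huv
    · exact ⟨tail, le_rfl, by omega, by simp⟩
    · rw [Function.update_of_ne huv] at hu
      exact absurd (hcur u hu) hc
  · intro i hi hi'
    obtain rfl : i = tail := by omega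
    simp
  · simp only [Function.update_apply]; grind
  · rw [Function.update_apply]
    split_ifs
    · omega
    · exact hle u

/-- The first vertex of the queue has no more arcs to scan. -/
theorem Colouring.next (h : A.Colouring χ col cur q qh tail) (hq : qh < tail)
    (hc : cur (q qh) = 0) : A.Colouring χ col cur q (qh + 1) tail := by
  obtain ⟨h1, h2, h3, h4, h5, h6, h7, hle⟩ := h
  refine ⟨h1, h2, h3, fun u hu hcu => ?_, fun i hi => h5 i (by omega), h6, hq, hle⟩
  obtain ⟨i, hi, hi', hqi⟩ := h4 u hu hcu
  refine ⟨i, ?_, hi', hqi⟩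
  rcases hi.lt_or_eq with h | rfl
  · exact h
  · rw [hqi] at hc; exact absurd hc hcu

/-- The scanned arc leads to a vertex that is already coloured.  If all arcs of that vertex have
been scanned, then the reverse arc shows that the colours differ; otherwise both ends are coloured
as by `χ`. -/
theorem Colouring.scan (hA : A.Ok) (hχ : ∀ e < A.m, χ (A.l e) ≠ χ (A.r e))
    (hsym : ∀ e < A.m, ∃ e' < A.m, A.l e' = A.r e ∧ A.r e' = A.l e)
    (h : A.Colouring χ col cur q qh tail) {e : ℕ} (hq : qh < tail) (he : e < A.m)
    (hqe : q qh = A.l e) (hc : cur (A.l e) = e + 1) (hr : col (A.r e) ≠ 0) :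
    A.Colouring χ col (Function.update cur (A.l e) (A.nx e)) q qh tail := by
  have hcl : col (A.l e) ≠ 0 := hqe ▸ h.queue_col qh le_rfl hq
  obtain ⟨h1, h2, ⟨f, h3⟩, h4, h5, h6, h7, hle⟩ := h
  have hl := hA.lt_nx e he
  have hp := hA.ptr_nx e he
  have hne : col (A.l e) ≠ col (A.r e) := by
    by_cases hcr : cur (A.r e) = 0
    · obtain ⟨e', he', hl', hr'⟩ := hsym e he
      have := (h2 e' he' (by rw [hl', hcr]; exact Nat.zero_le _)).2
      rw [hl', hr'] at this
      exact this.symm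
    · rw [h3 _ hcl (by omega), h3 _ hr hcr]
      have := hχ e he
      revert this
      cases χ (A.l e) <;> cases χ (A.r e) <;> cases f <;> simp
  have hmono : ∀ u, Function.update cur (A.l e) (A.nx e) u ≠ 0 → cur u ≠ 0 := fun u hu => by
    rcases eq_or_ne u (A.l e) with rfl | hul
    · omega
    · rwa [Function.update_of_ne hul] at hu
  refine ⟨?_, ?_, ⟨f, fun u hu hcu => h3 u hu (hmono u hcu)⟩,
    fun u hu hcu => h4 u hu (hmono u hcu), h5, ?_, h7, hle⟩ <;>
    simp only [Function.update_apply] <;> grind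

/-- The scanned arc leads to an uncoloured vertex, which receives the other colour. -/
theorem Colouring.visit (hA : A.Ok) (hχ : ∀ e < A.m, χ (A.l e) ≠ χ (A.r e))
    (h : A.Colouring χ col cur q qh tail) {e : ℕ} (hq : qh < tail) (he : e < A.m)
    (hqe : q qh = A.l e) (hc : cur (A.l e) = e + 1) (hr : col (A.r e) = 0) :
    A.Colouring χ (Function.update col (A.r e) (if col (A.l e) = 1 then 2 else 1))
      (Function.update cur (A.l e) (A.nx e)) (Function.update q tail (A.r e)) qh (tail + 1) := by
  have hcl : col (A.l e) ≠ 0 := hqe ▸ h.queue_col qh le_rfl hq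
  have hne : A.l e ≠ A.r e := fun h => hcl (h ▸ hr)
  obtain ⟨h1, h2, ⟨f, h3⟩, h4, h5, h6, h7, hle⟩ := h
  have hl := hA.lt_nx e he
  have hp := hA.ptr_nx e he
  have hh := hA.lt_hd
  have hχe := hχ e he
  have hfe := h3 _ hcl (by omega)
  have hmono : ∀ u, Function.update cur (A.l e) (A.nx e) u ≠ 0 → cur u ≠ 0 := fun u hu => by
    rcases eq_or_ne u (A.l e) with rfl | hul
    · omega
    · rwa [Function.update_of_ne hul] at hu
  refine ⟨?_, ?_, ⟨f, fun u hu hcu => ?_⟩, ?_, ?_, ?_, by omega, fun u => ?_⟩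
  · simp only [Function.update_apply]; grind
  · intro e' he' hce
    have hre : A.l e' ≠ A.r e := fun h => by
      rw [Function.update_of_ne (by rw [h]; exact hne.symm), h6 e' he' (by rw [h, hr])] at hce
      have := hh e' he'
      omega
    simp only [Function.update_apply] at hce ⊢
    grind
  · rcases eq_or_ne u (A.r e) with rfl | hur
    · rw [Function.update_self, hfe]
      revert hχe
      cases χ (A.l e) <;> cases χ (A.r e) <;> cases f <;> simp
    · rw [Function.update_of_ne hur] at hu ⊢
      exact h3 u hu (hmono u hcu)
  · intro u hu hcu
    rcases eq_or_ne u (A.r e) with rfl | hur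
    · exact ⟨tail, by omega, by omega, by simp⟩
    · rw [Function.update_of_ne hur] at hu
      obtain ⟨i, hi, hi', hqi⟩ := h4 u hu (hmono u hcu)
      exact ⟨i, hi, by omega, by rw [Function.update_of_ne (by omega), hqi]⟩
  · intro i hi hi'
    rcases Nat.lt_succ_iff_lt_or_eq.1 hi' with hi' | rfl
    · rw [Function.update_of_ne (show i ≠ tail by omega), Function.update_apply]
      have := h5 i hi hi'
      split_ifs <;> simp [this]
    · rw [Function.update_self, Function.update_self]
      split_ifs <;> simp
  · simp only [Function.update_apply]; grind
  · have := hle u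
    rw [Function.update_apply]
    split_ifs <;> omega

end ArcList

/-- One step of the colouring: the first vertex in the queue scans one arc or leaves the queue. -/
def colourStep : Program :=
  .seq (.assign 7 (get 14 (var 12))) <|
  .seq (.assign 8 (get 12 (var 7))) <|
  .ite (eq (var 8) (lit 0))
    (.assign 12 (succ (var 12)))
    (.seq (.assign 8 (pred (var 8))) <|
     .seq (.store 12 (var 7) (get 6 (var 8))) <|
     .ite (eq (get 15 (get 4 (var 8))) (lit 0))
      (.seq (.ite (eq (get 15 (var 7)) (lit 1))
          (.store 15 (get 4 (var 8)) (lit 2))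
          (.store 15 (get 4 (var 8)) (lit 1))) <|
       .seq (.store 14 (var 13) (get 4 (var 8))) <|
       .assign 13 (succ (var 13)))
      .skip)

/-- Colour the vertices with the colours `1` and `2`, in array `15`. -/
def colour : Program :=
  .seq (.assign 12 (lit 0)) <|
  .seq (.assign 13 (lit 0)) <|
  .seq (forLoop 6 0 <| .store 12 (var 6) (get 5 (var 6))) <|
  forLoop 6 0 <|
    .ite (eq (get 15 (var 6)) (lit 0))
      (.seq (.store 15 (var 6) (lit 1)) <|
       .seq (.store 14 (var 13) (var 6)) <|
       .seq (.assign 13 (succ (var 13))) <|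
       .loop (lt (var 12) (var 13)) colourStep)
      .skip

/-- The invariant of the colouring, for the arrays and registers of the program. -/
structure ColourState (A : ArcList) (χ : ℕ → Bool) (σ : State) : Prop where
  arcs : σ.arcs = A
  colouring : A.Colouring χ (σ.arr 15) (σ.arr 12) (σ.arr 14) (σ.reg 12) (σ.reg 13)

variable {χ : ℕ → Bool}

/-- One iteration of the colouring is paid for by the credit, and uncolours no vertex. -/
theorem ColourState.step (hA : A.Ok) (hχ : ∀ e < A.m, χ (A.l e) ≠ χ (A.r e))
    (hsym : ∀ e < A.m, ∃ e' < A.m, A.l e' = A.r e ∧ A.r e' = A.l e)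
    (h : ColourState A χ σ) (hq : σ.reg 12 < σ.reg 13) :
    WP colourStep σ fun τ t => ColourState A χ τ ∧ t ≤ 60 ∧
      τ.searchCredit A + 63 ≤ σ.searchCredit A ∧
      ∀ v, σ.arr 15 v ≠ 0 → τ.arr 15 v ≠ 0 := by
  obtain ⟨harcs, hs⟩ := h
  have hr : σ.arr 4 = A.r := by rw [← harcs]; rfl
  have hnx : σ.arr 6 = A.nx := by rw [← harcs]; rfl
  simp only [State.searchCredit]
  refine WP.of_forall fun Q hQ => ?_
  rcases hc : σ.arr 12 (σ.arr 14 (σ.reg 12)) with _ | e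
  · have hs' := hs.next hq hc
    have hcr := A.searchCredit_next (K := 63) (cur := σ.arr 12) hq
    simp [colourStep, hc]
    refine hQ _ _ ⟨⟨?_, ?_⟩, ?_, ?_, ?_⟩
    · simpa [State.arcs] using harcs
    · simpa using hs'
    · norm_num
    · simpa using hcr
    · simp
  · obtain ⟨he, hle⟩ := hs.ptr _ e hc
    have hqe := hle.symm
    rw [hqe] at hc
    by_cases hv : σ.arr 15 (A.r e) = 0
    · have hs' := hs.visit hA hχ hq he hqe hc hv
      have hcr := A.searchCredit_push (K := 63) (qh := σ.reg 12) (tail := σ.reg 13) hA he hc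
        hq.le
      simp [colourStep, hqe, hc, hr, hnx, hv]
      constructor <;> intro hcol <;> refine hQ _ _ ⟨⟨?_, ?_⟩, ?_, ?_, ?_⟩
      · simpa [State.arcs] using harcs
      · simpa [hcol] using hs'
      · norm_num
      · simp; omega
      · intro v; simp [Function.update_apply]; grind
      · simpa [State.arcs] using harcs
      · simpa [hcol] using hs'
      · norm_num
      · simp; omega
      · intro v; simp [Function.update_apply]; grind
    · have hs' := hs.scan hA hχ hsym hq he hqe hc hv
      have hcr := A.searchCredit_advance (K := 63) (qh := σ.reg 12) (tail := σ.reg 13) hA he hc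
      simp [colourStep, hqe, hc, hr, hnx, hv]
      refine hQ _ _ ⟨⟨?_, ?_⟩, ?_, ?_, ?_⟩
      · simpa [State.arcs] using harcs
      · simpa using hs'
      · norm_num
      · simpa using hcr
      · simp

theorem colour_spec (hA : A.Ok) (hχ : ∀ e < A.m, χ (A.l e) ≠ χ (A.r e))
    (hsym : ∀ e < A.m, ∃ e' < A.m, A.l e' = A.r e ∧ A.r e' = A.l e) {n : ℕ}
    (hn : ∀ e < A.m, A.l e < n) (h0 : σ.reg 0 = n) (harcs : σ.arcs = A)
    (h12 : σ.arr 12 = 0) (h15 : σ.arr 15 = 0) :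
    WP colour σ fun τ t => τ.arcs = A ∧
      (∀ e < A.m, τ.arr 15 (A.l e) ≠ τ.arr 15 (A.r e) ∧
        (τ.arr 15 (A.l e) = 1 ∨ τ.arr 15 (A.l e) = 2)) ∧ t ≤ n * 130 + A.m * 200 + 30 := by
  rw [colour]
  simp only [WP_seq, WP_assign]
  have hhd : σ.arr 5 = A.hd := by rw [← harcs]; rfl
  refine (WP_forLoop (by decide) (by decide) (by decide) (c := 10)
    (fun i τ φ => τ.arcs = A ∧ τ.reg 0 = n ∧ τ.reg 12 = 0 ∧ τ.reg 13 = 0 ∧ τ.arr 15 = 0 ∧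
      τ.arr 12 = (fun u => if u < i then A.hd u else 0) ∧ φ = 0) ?_
      (by simpa using h0) (φ := 0) ?_).mono ?_
  · rintro i hi τ φ ⟨h1, h2, h3, h4, h5, h6, rfl⟩ hj
    have hhd : τ.arr 5 = A.hd := by rw [← h1]; rfl
    simp [hj, hhd, h2, h3, h4, h5]
    constructor
    · simpa [State.arcs] using h1
    · funext u
      simp only [Function.update_apply, h6]
      grind
  · refine ⟨by simpa [State.arcs] using harcs, by simpa using h0, by simp, by simp,
      by simpa using h15, ?_, rfl⟩
    simp [h12]
    rfl
  rintro τ t ⟨φ, ⟨h1, h2, h3, h4, h5, h6, rfl⟩, ht⟩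
  refine (WP_forLoop (by decide) (by decide) (by decide) (c := 100)
    (fun i τ φ => ColourState A χ τ ∧ τ.reg 12 = τ.reg 13 ∧ (∀ v < i, τ.arr 15 v ≠ 0) ∧
      φ = τ.searchCredit A) ?_ h2 ⟨⟨by simpa [State.arcs] using h1, ?_⟩, ?_, by simp, rfl⟩).mono ?_
  · rintro j hj τ φ ⟨hτ, hq, hcol, rfl⟩ hτj
    rw [WP_ite]
    simp only [Test.Holds, Expr.eval, hτj, WP_seq, WP_store, WP_assign, WP_skip]
    refine ⟨fun hv => ?_, fun hv => ?_⟩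
    · have hs := hτ.colouring
      rw [hq] at hs
      have hs' := hs.seed hA hv
      refine (WP_loop (fun υ φ => ColourState A χ υ ∧ φ = υ.searchCredit A ∧
        ∀ v < j + 1, υ.arr 15 v ≠ 0) ?_ ⟨⟨?_, ?_⟩, rfl, ?_⟩).mono ?_
      · rintro υ φ ⟨hυ, rfl, hcol⟩ hb
        refine (hυ.step hA hχ hsym hb).mono ?_
        rintro υ' s ⟨h1, h2, h3, h4⟩
        exact ⟨_, ⟨h1, rfl, fun v hv => h4 v (hcol v hv)⟩, by simp; omega⟩
      · simpa [State.arcs] using hτ.arcs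
      · simpa [hq, hτj] using hs'
      · intro v hv
        simp [Function.update_apply, hτj]
        have := hcol v
        grind
      · rintro υ s ⟨hn, φ', ⟨hυ, rfl, hcol⟩, hs⟩
        refine ⟨_, ⟨⟨by simpa [State.arcs] using hυ.arcs, by simpa using hυ.colouring⟩, ?_,
          by simpa using hcol, rfl⟩, ?_⟩
        · simp at hn ⊢
          exact le_antisymm hυ.colouring.qh_le hn
        · have hcr : A.searchCredit 63 (τ.arr 12) (τ.reg 13) (τ.reg 13 + 1) =
              A.searchCredit 63 (τ.arr 12) (τ.reg 13) (τ.reg 13) + 63 := by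
            simp [ArcList.searchCredit]
          simp [State.searchCredit, hq, hcr] at hs ⊢
          omega
    · refine ⟨_, ⟨⟨by simpa [State.arcs] using hτ.arcs, by simpa using hτ.colouring⟩,
        by simpa using hq, ?_, rfl⟩, ?_⟩
      · intro v hvj
        simp only [State.setR_arr]
        rcases Nat.lt_succ_iff_lt_or_eq.1 hvj with h | rfl
        · exact hcol v h
        · exact hv
      · simp [State.searchCredit]
        omega
  · simp only [State.setR_arr, State.setR_reg, h3, h4, h5, h6]
    refine ArcList.Colouring.init hA (fun e he => by simp [hn e he]) fun u => ?_
    have := hA.ptr_hd u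
    simp only [ArcList.Ptr] at this ⊢
    grind
  · simp [h3, h4]
  · rintro υ s ⟨φ, ⟨hυ, hq, hcol, rfl⟩, hs⟩
    refine ⟨hυ.arcs, fun e he => ?_, ?_⟩
    · have h := hυ.colouring
      have hne := hcol _ (hn e he)
      have hle := h.le_two (A.l e)
      refine ⟨(h.proper e he ?_).2, by omega⟩
      have hcur : υ.arr 12 (A.l e) = 0 := by
        by_contra hc
        obtain ⟨i, hi, hi', -⟩ := h.queue _ (hcol _ (hn e he)) hc
        omega
      omega
    · have hcr : τ.searchCredit A ≤ (3 * A.m + τ.reg 13) * 63 := A.searchCredit_le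
      simp [State.searchCredit, h4] at hs hcr ⊢
      omega

/-! ### The level bound and the orientation -/

/-- Register `4` becomes the least `s` with `2 n ≤ s (s + 1)`.  Without multiplication, it is found
by counting to `n`: register `4` is raised after `1, 2, 3, …` further iterations. -/
def levelBound : Program :=
  .seq (.assign 4 (lit 0)) <|
  .seq (.assign 7 (lit 0)) <|
  forLoop 6 0 <|
    .ite (eq (var 7) (lit 0))
      (.seq (.assign 7 (var 4)) (.assign 4 (succ (var 4))))
      (.assign 7 (pred (var 7)))

theorem levelBound_spec {n : ℕ} (h0 : σ.reg 0 = n) :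
    WP levelBound σ fun τ t => 2 * n ≤ τ.reg 4 * (τ.reg 4 + 1) ∧
      τ.reg 4 * (τ.reg 4 + 1) ≤ 2 * n + 2 * τ.reg 4 ∧ t ≤ n * 20 + 20 := by
  rw [levelBound]
  simp only [WP_seq, WP_assign]
  refine (WP_forLoop (by decide) (by decide) (by decide) (c := 14)
    (fun i τ φ => τ.reg 4 * (τ.reg 4 + 1) = 2 * i + 2 * τ.reg 7 ∧ τ.reg 7 ≤ τ.reg 4 ∧ φ = 0) ?_
      (by simpa using h0) (φ := 0) (by simp)).mono ?_
  · rintro i hi τ φ ⟨h1, h2, rfl⟩ hj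
    simp
    refine ⟨fun h => ?_, fun h => ?_⟩
    · rw [h] at h1
      nlinarith
    · omega
  · rintro τ t ⟨φ, ⟨h1, h2, rfl⟩, ht⟩
    simp
    omega

/-- Only the arcs that leave vertices of colour `2` stay alive. -/
def orient : Program :=
  forLoop 6 3 <|
    .ite (eq (get 15 (get 3 (var 6))) (lit 2)) .skip (.store 7 (var 6) (lit 1))

theorem orient_spec {m : ℕ} (hm : σ.reg 3 = m) (h7 : σ.arr 7 = 0) :
    WP orient σ fun τ t => (∀ e < m, τ.arr 7 e = 0 ↔ σ.arr 15 (σ.arr 3 e) = 2) ∧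
      t ≤ m * 20 + 5 := by
  refine (WP_forLoop (by decide) (by decide) (by decide) (c := 14)
    (fun i τ φ => τ.arr 15 = σ.arr 15 ∧ τ.arr 3 = σ.arr 3 ∧ (∀ e, i ≤ e → τ.arr 7 e = 0) ∧
      (∀ e < i, τ.arr 7 e = 0 ↔ σ.arr 15 (σ.arr 3 e) = 2) ∧ φ = 0) ?_
      hm (φ := 0) (by simp [h7])).mono ?_
  · rintro i hi τ φ ⟨h15, h3, hz, h, rfl⟩ hj
    simp [hj, h15, h3]
    refine ⟨fun hc => ⟨fun e he => hz e (by omega), fun e he => ?_⟩,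
      fun hc => ⟨fun e he => ?_, fun e he => ?_⟩⟩
    · rcases he.lt_or_eq with he | rfl
      · exact h e he
      · simp [hz e le_rfl, hc]
    · rw [Function.update_of_ne (by omega)]
      exact hz e (by omega)
    · rcases he.lt_or_eq with he | rfl
      · rw [Function.update_of_ne (by omega)]
        exact h e he
      · simp [hc]
  · rintro τ t ⟨φ, ⟨-, -, -, h, rfl⟩, ht⟩
    exact ⟨h, by omega⟩

/-- The matched arcs die. -/
def removeMatched : Program :=
  forLoop 6 3 <|
    .ite (eq (get 8 (get 3 (var 6))) (succ (var 6))) (.store 7 (var 6) (lit 1)) .skip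

theorem removeMatched_spec {m : ℕ} (hm : σ.reg 3 = m) :
    WP removeMatched σ fun τ t =>
      (∀ e < m, τ.arr 7 e = 0 ↔ σ.arr 7 e = 0 ∧ σ.arr 8 (σ.arr 3 e) ≠ e + 1) ∧
      t ≤ m * 20 + 5 := by
  refine (WP_forLoop (by decide) (by decide) (by decide) (c := 14)
    (fun i τ φ => τ.arr 8 = σ.arr 8 ∧ τ.arr 3 = σ.arr 3 ∧ (∀ e, i ≤ e → τ.arr 7 e = σ.arr 7 e) ∧
      (∀ e < i, τ.arr 7 e = 0 ↔ σ.arr 7 e = 0 ∧ σ.arr 8 (σ.arr 3 e) ≠ e + 1) ∧ φ = 0) ?_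
      hm (φ := 0) (by simp)).mono ?_
  · rintro i hi τ φ ⟨h8, h3, hz, h, rfl⟩ hj
    simp [hj, h8, h3]
    refine ⟨fun hc => ⟨fun e he => ?_, fun e he => ?_⟩,
      fun hc => ⟨fun e he => hz e (by omega), fun e he => ?_⟩⟩
    · rw [Function.update_of_ne (by omega)]
      exact hz e (by omega)
    · rcases he.lt_or_eq with he | rfl
      · rw [Function.update_of_ne (by omega)]
        exact h e he
      · simp [hc]
    · rcases he.lt_or_eq with he | rfl
      · exact h e he
      · simp [hz e le_rfl, hc]
  · rintro τ t ⟨φ, ⟨-, -, -, h, rfl⟩, ht⟩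
    exact ⟨h, by omega⟩

/-! ### The residual graphs and their arc lists -/

variable {n : ℕ} {col cur par : ℕ → ℕ} {H : SimpleGraph (Fin n)}

/-- The alive arcs are the edges of `H`, each represented once, by the arc that leaves its end of
colour `2`. -/
structure Represents (A : ArcList) (n : ℕ) (col dd : ℕ → ℕ) (H : SimpleGraph (Fin n)) : Prop where
  lt : ∀ e < A.m, A.l e < n ∧ A.r e < n
  side : ∀ e < A.m, dd e = 0 → col (A.l e) = 2 ∧ col (A.r e) ≠ 2
  inj : ∀ e < A.m, ∀ e' < A.m, dd e = 0 → dd e' = 0 → A.l e = A.l e' → A.r e = A.r e' → e = e'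
  adj : ∀ x y : Fin n, H.Adj x y ↔ ∃ e < A.m, dd e = 0 ∧
    (A.l e = x ∧ A.r e = y ∨ A.l e = y ∧ A.r e = x)

theorem ArcList.Consistent.alive {X : Set ℕ} (h : A.Consistent dd ml mr X) {e : ℕ}
    (he : e ∈ A.matched ml) : e < A.m ∧ dd e = 0 := by
  obtain ⟨h1, h2⟩ := ArcList.mem_matched.1 he
  exact ⟨h1, (h.left e h1 e h2).2.2.1⟩

/-- The matched arcs form a matching of the represented graph. -/
theorem Represents.exists_matching (h : Represents A n col dd H)
    (hc : A.Consistent dd ml mr ∅) :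
    ∃ M : H.Subgraph, M.IsMatching ∧ M.edgeSet.ncard = (A.matched ml).card ∧
      ∀ x y, s(x, y) ∈ M.edgeSet ↔ ∃ e ∈ A.matched ml,
        A.l e = (x : ℕ) ∧ A.r e = y ∨ A.l e = y ∧ A.r e = x := by
  set a : A.matched ml → Fin n := fun e => ⟨A.l e, (h.lt e (hc.alive e.2).1).1⟩ with ha
  set b : A.matched ml → Fin n := fun e => ⟨A.r e, (h.lt e (hc.alive e.2).1).2⟩ with hb
  have hainj : Function.Injective a := fun e e' hee =>
    Subtype.ext (ArcList.injOn_l_matched e.2 e'.2 (Fin.mk.inj_iff.1 hee))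
  have hbinj : Function.Injective b := fun e e' hee =>
    Subtype.ext (hc.injOn_r_matched e.2 e'.2 (Fin.mk.inj_iff.1 hee))
  have hne : ∀ e e', a e ≠ b e' := fun e e' hee => by
    have h1 := (h.side e (hc.alive e.2).1 (hc.alive e.2).2).1
    have h2 := (h.side e' (hc.alive e'.2).1 (hc.alive e'.2).2).2
    rw [Fin.mk.inj_iff.1 hee] at h1
    exact h2 h1
  obtain ⟨M, hM, hMe⟩ := KDep.exists_isMatching_of_disjoint_edges (G := H) (a := a) (b := b)
    (fun e => (h.adj _ _).2 ⟨e, (hc.alive e.2).1, (hc.alive e.2).2, Or.inl ⟨rfl, rfl⟩⟩)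
    hainj hbinj hne
  refine ⟨M, hM, ?_, fun x y => ?_⟩
  · rw [hMe, Set.ncard_range_of_injective (KDep.injective_edges hainj hne)]
    simp
  · rw [hMe]
    simp only [Set.mem_range, Sym2.eq_iff, ha, hb, Fin.ext_iff, Subtype.exists, exists_prop]

/-- The vertex cover found by a search without success.  The entries of `cur` and `par` are
meaningless at isolated vertices, which are left out. -/
def searchCover (A : ArcList) (n : ℕ) (col cur par : ℕ → ℕ) : Finset (Fin n) :=
  Finset.univ.filter fun v => A.hd v ≠ 0 ∧ if col v = 2 then cur v ≠ 0 else par v ≠ 0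

theorem isVertexCover_searchCover (hA : A.Ok)
    (hsym : ∀ e < A.m, ∃ e' < A.m, A.l e' = A.r e ∧ A.r e' = A.l e)
    (h : Represents A n col dd H) (ho : A.Optimal dd ml mr cur par) :
    H.IsVertexCover (searchCover A n col cur par) := by
  have key : ∀ e < A.m, dd e = 0 → ∀ x y : Fin n, A.l e = x → A.r e = y →
      x ∈ searchCover A n col cur par ∨ y ∈ searchCover A n col cur par := by
    intro e he hd x y hx hy
    obtain ⟨e', he', hl', -⟩ := hsym e he
    have h1 := hA.lt_hd e he
    have h2 := hA.lt_hd e' he'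
    have h3 := h.side e he hd
    have h4 := ho.closed e he hd
    rw [hl'] at h2
    rw [hx] at h1 h3 h4
    rw [hy] at h2 h3 h4
    simp only [searchCover, Finset.mem_filter, Finset.mem_univ, true_and, h3.1, h3.2, if_true,
      if_false]
    by_cases hc : cur x = 0
    · exact Or.inr ⟨by omega, h4 hc⟩
    · exact Or.inl ⟨by omega, hc⟩
  intro x y hxy
  obtain ⟨e, he, hd, ⟨hx, hy⟩ | ⟨hy, hx⟩⟩ := (h.adj x y).1 hxy
  · exact key e he hd x y hx hy
  · exact (key e he hd y x hy hx).symm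

/-- Every vertex of the cover is matched, and by different arcs: the arcs of its left vertices have
a left end `u` with `cur u ≠ 0`, those of its right vertices have not. -/
theorem card_searchCover_le (hA : A.Ok)
    (hsym : ∀ e < A.m, ∃ e' < A.m, A.l e' = A.r e ∧ A.r e' = A.l e)
    (ho : A.Optimal dd ml mr cur par) :
    (searchCover A n col cur par).card ≤ (A.matched ml).card := by
  have hleft : ∀ v : Fin n, v ∈ searchCover A n col cur par → col v = 2 →
      cur v ≠ 0 ∧ ∃ f ∈ A.matched ml, ml v = f + 1 ∧ A.l f = v := by
    intro v hv hcol
    simp only [searchCover, Finset.mem_filter, Finset.mem_univ, true_and, hcol, if_true] at hv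
    obtain ⟨e, he⟩ := Nat.exists_eq_succ_of_ne_zero hv.1
    obtain ⟨he, hl⟩ := hA.ptr_hd v e he
    obtain ⟨f, hf⟩ := Nat.exists_eq_succ_of_ne_zero (ho.left e he (by rw [hl]; exact hv.2))
    obtain ⟨hf1, hf2, -⟩ := ho.cons.left e he f hf
    rw [hl] at hf hf2
    exact ⟨hv.2, f, ArcList.mem_matched.2 ⟨hf1, by rw [hf2, hf]⟩, hf, hf2⟩
  have hright : ∀ v : Fin n, v ∈ searchCover A n col cur par → col v ≠ 2 →
      ∃ f ∈ A.matched ml, mr v = f + 1 ∧ A.r f = v ∧ cur (A.l f) = 0 := by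
    intro v hv hcol
    simp only [searchCover, Finset.mem_filter, Finset.mem_univ, true_and, hcol, if_false] at hv
    obtain ⟨e, he⟩ := Nat.exists_eq_succ_of_ne_zero hv.1
    obtain ⟨he, hl⟩ := hA.ptr_hd v e he
    obtain ⟨e', he', -, hr⟩ := hsym e he
    rw [hl] at hr
    obtain ⟨f, hf, hcf⟩ := ho.right e' he' (by rw [hr]; exact hv.2)
    obtain ⟨hf1, hf2, hf3⟩ := ho.cons.right e' he' f (by simp) hf
    rw [hr] at hf hf2
    exact ⟨f, ArcList.mem_matched.2 ⟨hf1, hf3⟩, hf, hf2, hcf⟩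
  refine Finset.card_le_card_of_injOn (fun v => if col v = 2 then ml v - 1 else mr v - 1) ?_ ?_
  · intro v hv
    dsimp only
    split_ifs with hcol
    · obtain ⟨-, f, hf, hmf, -⟩ := hleft v hv hcol
      rw [hmf]; exact hf
    · obtain ⟨f, hf, hmf, -⟩ := hright v hv hcol
      rw [hmf]; exact hf
  · intro v hv w hw hvw
    dsimp only at hvw
    split_ifs at hvw with h1 h2 h2
    · obtain ⟨-, f, -, hmf, hf⟩ := hleft v hv h1
      obtain ⟨-, g, -, hmg, hg⟩ := hleft w hw h2
      rw [hmf, hmg] at hvw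
      obtain rfl : f = g := by omega
      exact Fin.ext (hf.symm.trans hg)
    · obtain ⟨hcv, f, -, hmf, hf⟩ := hleft v hv h1
      obtain ⟨g, -, hmg, hg, hcg⟩ := hright w hw h2
      rw [hmf, hmg] at hvw
      obtain rfl : f = g := by omega
      rw [hf] at hcg
      exact absurd hcg hcv
    · obtain ⟨f, -, hmf, hf, hcf⟩ := hright v hv h1
      obtain ⟨hcw, g, -, hmg, hg⟩ := hleft w hw h2
      rw [hmf, hmg] at hvw
      obtain rfl : f = g := by omega
      rw [hg] at hcf
      exact absurd hcf hcw
    · obtain ⟨f, -, hmf, hf, -⟩ := hright v hv h1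
      obtain ⟨g, -, hmg, hg, -⟩ := hright w hw h2
      rw [hmf, hmg] at hvw
      obtain rfl : f = g := by omega
      exact Fin.ext (hf.symm.trans hg)

/-- Removing the matched arcs deletes the edges of the matching. -/
theorem Represents.deleteEdges (h : Represents A n col dd H) (hc : A.Consistent dd ml mr ∅)
    {M : H.Subgraph} (hM : ∀ x y, s(x, y) ∈ M.edgeSet ↔ ∃ e ∈ A.matched ml,
        A.l e = (x : ℕ) ∧ A.r e = y ∨ A.l e = y ∧ A.r e = x) {dd' : ℕ → ℕ}
    (hd' : ∀ e < A.m, dd' e = 0 ↔ dd e = 0 ∧ ml (A.l e) ≠ e + 1) :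
    Represents A n col dd' (H.deleteEdges M.edgeSet) where
  lt := h.lt
  side e he hd := h.side e he ((hd' e he).1 hd).1
  inj e he e' he' hd hde := h.inj e he e' he' ((hd' e he).1 hd).1 ((hd' e' he').1 hde).1
  adj x y := by
    rw [SimpleGraph.deleteEdges_adj, h.adj, hM]
    constructor
    · rintro ⟨⟨e, he, hd, hxy⟩, hn⟩
      exact ⟨e, he, (hd' e he).2 ⟨hd, fun hm => hn ⟨e, ArcList.mem_matched.2 ⟨he, hm⟩, hxy⟩⟩, hxy⟩
    · rintro ⟨e, he, hd, hxy⟩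
      obtain ⟨hd, hm⟩ := (hd' e he).1 hd
      refine ⟨⟨e, he, hd, hxy⟩, ?_⟩
      rintro ⟨f, hf, hf'⟩
      obtain ⟨hfm, hfd⟩ := hc.alive hf
      have h1 := h.side e he hd
      have h2 := h.side f hfm hfd
      -- The colours exclude that `e` and `f` are opposite.
      have hef : A.l e = A.l f ∧ A.r e = A.r f := by
        rcases hxy with ⟨hx, hy⟩ | ⟨hx, hy⟩ <;> rcases hf' with ⟨hx', hy'⟩ | ⟨hx', hy'⟩ <;>
          rw [hx, hy] at h1 <;> rw [hx', hy'] at h2 <;> simp_all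
      obtain rfl := h.inj e he f hfm hd hfd hef.1 hef.2
      exact hm (ArcList.mem_matched.1 hf).2

/-! ### The program -/

/-- The `k` rounds of the algorithm. -/
def rounds : Program := forLoop 5 2 <| .seq maximumMatching removeMatched

/-- Output the vertices outside the cover found by the last search. -/
def output : Program :=
  forLoop 6 0 <|
    .ite (eq (get 5 (var 6)) (lit 0)) (.store 2 (var 6) (lit 1)) <|
    .ite (eq (get 15 (var 6)) (lit 2))
      (.ite (eq (get 12 (var 6)) (lit 0)) (.store 2 (var 6) (lit 1)) .skip)
      (.ite (eq (get 13 (var 6)) (lit 0)) (.store 2 (var 6) (lit 1)) .skip)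

/-- The whole program.  A graph without edges is treated separately, since it leaves no time for
`k` rounds. -/
def algorithm : Program :=
  .ite (eq (var 1) (lit 0))
    (forLoop 6 0 <| .store 2 (var 6) (lit 1)) <|
    .seq buildArcs <|
    .seq colour <|
    .seq levelBound <|
    .seq orient <|
    .seq rounds <|
    .seq maximumMatching output

theorem output_spec (hn : σ.reg 0 = n) (h2 : σ.arr 2 = 0) :
    WP output σ fun τ t => (∀ v < n, τ.arr 2 v = 1 ↔ ¬ (σ.arr 5 v ≠ 0 ∧
      if σ.arr 15 v = 2 then σ.arr 12 v ≠ 0 else σ.arr 13 v ≠ 0)) ∧ t ≤ n * 30 + 5 := by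
  refine (WP_forLoop (by decide) (by decide) (by decide) (c := 24)
    (fun i τ φ => (∀ a, a ≠ 2 → τ.arr a = σ.arr a) ∧ (∀ v, i ≤ v → τ.arr 2 v = 0) ∧
      (∀ v < i, τ.arr 2 v = 1 ↔ ¬ (σ.arr 5 v ≠ 0 ∧
        if σ.arr 15 v = 2 then σ.arr 12 v ≠ 0 else σ.arr 13 v ≠ 0)) ∧ φ = 0) ?_
      hn (φ := 0) (by simp [h2])).mono ?_
  · rintro i hi τ φ ⟨ha, hz, h, rfl⟩ hj
    refine WP.of_forall fun Q hQ => ?_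
    have hset : ¬ (σ.arr 5 i ≠ 0 ∧ if σ.arr 15 i = 2 then σ.arr 12 i ≠ 0 else σ.arr 13 i ≠ 0) →
        ∀ t ≤ 24, Q (τ.setA 2 i 1) t := by
      intro hcond t ht
      refine hQ _ _ ⟨0, ⟨fun a h2 => ?_, fun v hv => ?_, fun v hv => ?_, rfl⟩, by omega⟩
      · simp [h2, ha a h2]
      · simp only [State.setR_arr, State.setA_arr, if_true]
        rw [Function.update_of_ne (by omega)]
        exact hz v (by omega)
      · simp only [State.setR_arr, State.setA_arr, if_true]
        rcases Nat.lt_succ_iff_lt_or_eq.1 hv with hv | rfl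
        · rw [Function.update_of_ne (by omega)]
          exact h v hv
        · rw [Function.update_self]
          exact ⟨fun _ => hcond, fun _ => rfl⟩
    have hskip : (σ.arr 5 i ≠ 0 ∧ if σ.arr 15 i = 2 then σ.arr 12 i ≠ 0 else σ.arr 13 i ≠ 0) →
        ∀ t ≤ 24, Q τ t := by
      intro hcond t ht
      refine hQ _ _ ⟨0, ⟨ha, fun v hv => hz v (by omega), fun v hv => ?_, rfl⟩, by omega⟩
      rcases Nat.lt_succ_iff_lt_or_eq.1 hv with hv | rfl
      · exact h v hv
      · simp only [State.setR_arr, hz v le_rfl]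
        exact ⟨fun h => by omega, fun h => absurd hcond h⟩
    simp [hj, ha 5 (by norm_num), ha 15 (by norm_num), ha 12 (by norm_num), ha 13 (by norm_num)]
    refine ⟨fun h5 => hset (by simp [h5]) _ (by norm_num), fun h5 =>
      ⟨fun h15 => ⟨fun h12 => hset (by simp [h15, h12]) _ (by norm_num),
        fun h12 => hskip (by simp [h5, h15, h12]) _ (by norm_num)⟩,
      fun h15 => ⟨fun h13 => hset (by simp [h15, h13]) _ (by norm_num),
        fun h13 => hskip (by simp [h5, h15, h13]) _ (by norm_num)⟩⟩⟩
  · rintro τ t ⟨φ, ⟨-, -, h, rfl⟩, ht⟩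
    exact ⟨h, by omega⟩

theorem card_matched_le (hlt : ∀ e < A.m, A.l e < n) : (A.matched ml).card ≤ n := by
  rw [← Finset.card_image_of_injOn (ArcList.injOn_l_matched (A := A) (ml := ml))]
  refine (Finset.card_le_card (t := Finset.range n) fun v hv => ?_).trans (by simp)
  obtain ⟨e, he, rfl⟩ := Finset.mem_image.1 hv
  exact Finset.mem_range.2 (hlt e (ArcList.mem_matched.1 he).1)

/-- The rounds construct a residual sequence. -/
theorem rounds_spec (hA : A.Ok) (hm : 0 < A.m)
    (hsym : ∀ e < A.m, ∃ e' < A.m, A.l e' = A.r e ∧ A.r e' = A.l e) {G : SimpleGraph (Fin n)}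
    {k : ℕ} (hk : σ.reg 2 = k) (hL : 2 * n ≤ L * (L + 1)) (henv : Env A L dd σ)
    (h : Represents A n (σ.arr 15) dd G) :
    WP rounds σ fun τ t => (∃ H dd', KDep.IsResidualSequence G k H ∧ Env A L dd' τ ∧
      Represents A n (σ.arr 15) dd' (H k)) ∧ t ≤ k * (A.m * (L + 2) * 1100) + 5 := by
  refine (WP_forLoop (by decide) (by decide) (by decide) (c := A.m * (L + 2) * 1100 - 6)
    (fun i τ φ => τ.arr 15 = σ.arr 15 ∧ φ = 0 ∧ ∃ H dd', KDep.IsResidualSequence G i H ∧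
      Env A L dd' τ ∧ Represents A n (σ.arr 15) dd' (H i)) ?_ hk (φ := 0)
    ⟨rfl, rfl, fun _ => G, dd, ⟨rfl, fun i hi => by omega⟩, henv.setR, h⟩).mono ?_
  · rintro i hi τ φ ⟨h15, rfl, H, dd', hH, hτ, hrep⟩ hj
    rw [WP_seq]
    refine (maximumMatching_spec hA hm hτ fun ml mr hc => ?_).frame.mono ?_
    · have := card_matched_le (ml := ml) fun e he => (hrep.lt e he).1
      nlinarith
    rintro τ₁ t₁ ⟨⟨h₁, hopt, ht₁⟩, -, ha₁⟩
    refine (removeMatched_spec h₁.m).frame.mono ?_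
    rintro τ₂ t₂ ⟨⟨h₂, ht₂⟩, hr₂, ha₂⟩
    rw [h₁.dd, h₁.l] at h₂
    obtain ⟨M, hM, hcard, hMe⟩ := hrep.exists_matching hopt.cons
    have hmax : KDep.IsMaximumMatching M := KDep.isMaximumMatching_of_isVertexCover hM
      (isVertexCover_searchCover hA hsym hrep hopt)
      ((card_searchCover_le hA hsym hopt).trans hcard.ge)
    refine ⟨0, ⟨?_, rfl, _, τ₂.arr 7, hH.extend hmax, ?_, ?_⟩, ?_⟩
    · simp [ha₂ 15 (by decide), ha₁ 15 (by decide), h15]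
    · refine Env.setR ⟨?_, ?_, ?_, ?_, ?_, ?_, rfl⟩
      · rw [hr₂ 3 (by decide), h₁.m]
      · rw [hr₂ 4 (by decide), h₁.L]
      · rw [ha₂ 3 (by decide), h₁.l]
      · rw [ha₂ 4 (by decide), h₁.r]
      · rw [ha₂ 5 (by decide), h₁.hd]
      · rw [ha₂ 6 (by decide), h₁.nx]
    · rw [Function.update_self]
      exact hrep.deleteEdges hopt.cons hMe h₂
    · have : A.m ≤ A.m * (L + 2) := Nat.le_mul_of_pos_right _ (by omega)
      omega
  · rintro τ t ⟨φ, ⟨-, rfl, H, dd', hH, hτ, hrep⟩, ht⟩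
    refine ⟨⟨H, dd', hH, hτ, hrep⟩, ?_⟩
    have : A.m ≤ A.m * (L + 2) := Nat.le_mul_of_pos_right _ (by omega)
    rw [Nat.sub_add_cancel (by omega)] at ht
    omega

/-! ### The execution on an edge list -/

variable {G : SimpleGraph (Fin n)} {es : List (Fin n × Fin n)}

/-- Every arc runs along a listed edge; the parity of its index gives the direction. -/
theorem ArcList.Doubles.arc (h : A.Doubles es.length
    (fun i => (es.map fun e => (e.1 : ℕ)).getD i 0) fun i => (es.map fun e => (e.2 : ℕ)).getD i 0)
    {e : ℕ} (he : e < A.m) : ∃ i, ∃ hi : i < es.length,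
      (e = 2 * i ∧ A.l e = es[i].1 ∧ A.r e = es[i].2) ∨
      (e = 2 * i + 1 ∧ A.l e = es[i].2 ∧ A.r e = es[i].1) := by
  rw [h.m] at he
  have hi : e / 2 < es.length := by omega
  refine ⟨e / 2, hi, ?_⟩
  have h1 := h.l_even _ hi
  have h2 := h.r_even _ hi
  have h3 := h.l_odd _ hi
  have h4 := h.r_odd _ hi
  simp only [List.getD_eq_getElem?_getD, List.getElem?_map, List.getElem?_eq_getElem hi,
    Option.map_some, Option.getD_some] at h1 h2 h3 h4
  rcases Nat.mod_two_eq_zero_or_one e with hp | hp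
  · have he : e = 2 * (e / 2) := by omega
    rw [← he] at h1 h2
    exact Or.inl ⟨he, h1, h2⟩
  · have he : e = 2 * (e / 2) + 1 := by omega
    rw [← he] at h3 h4
    exact Or.inr ⟨he, h3, h4⟩

theorem ArcList.Doubles.exists_reverse {M : ℕ} {a b : ℕ → ℕ} (h : A.Doubles M a b) {e : ℕ}
    (he : e < A.m) : ∃ e' < A.m, A.l e' = A.r e ∧ A.r e' = A.l e := by
  rw [h.m] at he ⊢
  rcases Nat.even_or_odd' e with ⟨i, rfl | rfl⟩
  · exact ⟨2 * i + 1, by omega, by rw [h.l_odd i (by omega), h.r_even i (by omega)],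
      by rw [h.r_odd i (by omega), h.l_even i (by omega)]⟩
  · exact ⟨2 * i, by omega, by rw [h.l_even i (by omega), h.r_odd i (by omega)],
      by rw [h.r_even i (by omega), h.l_odd i (by omega)]⟩

/-- The arcs that leave vertices of colour `2` represent the whole graph. -/
theorem ArcList.Doubles.represents (hes : IsEdgeList G es) (h : A.Doubles es.length
    (fun i => (es.map fun e => (e.1 : ℕ)).getD i 0) fun i => (es.map fun e => (e.2 : ℕ)).getD i 0)
    (hcol : ∀ e < A.m, col (A.l e) ≠ col (A.r e) ∧ (col (A.l e) = 1 ∨ col (A.l e) = 2))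
    (hdd : ∀ e < A.m, dd e = 0 ↔ col (A.l e) = 2) : Represents A n col dd G where
  lt e he := by
    obtain ⟨i, hi, ⟨-, h1, h2⟩ | ⟨-, h1, h2⟩⟩ := h.arc he <;> rw [h1, h2] <;>
      exact ⟨Fin.isLt _, Fin.isLt _⟩
  side e he hd := by
    have h1 := (hdd e he).1 hd
    exact ⟨h1, fun h2 => (hcol e he).1 (h1.trans h2.symm)⟩
  inj e he e' he' _ _ hl hr := by
    have hne : A.l e ≠ A.r e := fun h => (hcol e he).1 (congrArg col h)
    obtain ⟨i, hi, hei⟩ := h.arc he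
    obtain ⟨j, hj, hej⟩ := h.arc he'
    have hij : i = j := by
      have hs : (es.map fun e => s(e.1, e.2))[i]'(by simpa using hi) =
          (es.map fun e => s(e.1, e.2))[j]'(by simpa using hj) := by
        rw [List.getElem_map, List.getElem_map, Sym2.eq_iff]
        simp only [Fin.ext_iff]
        omega
      exact (hes.1.getElem_inj_iff).1 hs
    subst hij
    omega
  adj x y := by
    rw [← SimpleGraph.mem_edgeSet, ← hes.2, List.mem_map]
    constructor
    · rintro ⟨e, he, hxy⟩
      obtain ⟨i, hi, rfl⟩ := List.getElem_of_mem he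
      have hm0 : 2 * i < A.m := by rw [h.m]; omega
      have hm1 : 2 * i + 1 < A.m := by rw [h.m]; omega
      obtain ⟨j, hj, ⟨hij, h1, h2⟩ | ⟨hij, -, -⟩⟩ := h.arc hm0
      swap
      · omega
      obtain ⟨j', hj', ⟨hij', -, -⟩ | ⟨hij', h3, h4⟩⟩ := h.arc hm1
      · omega
      obtain rfl : i = j := by omega
      obtain rfl : i = j' := by omega
      have hxy' : (es[i].1 : ℕ) = x ∧ (es[i].2 : ℕ) = y ∨
          (es[i].1 : ℕ) = y ∧ (es[i].2 : ℕ) = x := by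
        simpa only [Sym2.eq_iff, Fin.ext_iff] using hxy
      -- One of the two directions leaves the end of colour `2`.
      by_cases hc : col (A.l (2 * i)) = 2
      · exact ⟨2 * i, hm0, (hdd _ hm0).2 hc, by rw [h1, h2]; exact hxy'⟩
      · refine ⟨2 * i + 1, hm1, (hdd _ hm1).2 ?_, by rw [h3, h4]; tauto⟩
        have h5 := hcol _ hm0
        have h6 := (hcol _ hm1).2
        rw [h2, ← h3] at h5
        omega
    · rintro ⟨e, he, -, hxy⟩
      obtain ⟨i, hi, hei⟩ := h.arc he
      refine ⟨es[i], List.getElem_mem hi, ?_⟩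
      rw [Sym2.eq_iff]
      simp only [Fin.ext_iff]
      omega

/-- The run of the program on a graph with edges; `s` is the level bound. -/
theorem algorithm_spec {k : ℕ} (hk : 1 ≤ k) (hG : G.IsBipartite) (hes : IsEdgeList G es)
    (hpos : 0 < es.length) :
    WP algorithm (inputState n k es) fun τ t => KDep.IsAlgorithmOutput G k (outputSet n τ) ∧
      ∃ s, s * (s + 1) ≤ 2 * n + 2 * s ∧
        t ≤ 200 * n + 100 + 5000 * (k * es.length * (s + 2)) := by
  obtain ⟨c⟩ := hG
  set χ : ℕ → Bool := fun v => if h : v < n then decide (c ⟨v, h⟩ = 0) else false with hχdef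
  rw [algorithm, WP_ite]
  refine ⟨fun h => ?_, fun _ => ?_⟩
  · simp [inputState] at h
    simp [h] at hpos
  simp only [WP_seq]
  refine (buildArcs_spec (σ := inputState n k es) (M := es.length) (by simp [inputState])
    (by funext; simp [inputState])).frame.mono ?_
  rintro σ₁ t₁ ⟨⟨hd₁, ht₁⟩, hr₁, ha₁⟩
  have hdb : σ₁.arcs.Doubles es.length (fun i => (es.map fun e => (e.1 : ℕ)).getD i 0)
      fun i => (es.map fun e => (e.2 : ℕ)).getD i 0 := hd₁
  generalize hAdef : σ₁.arcs = A at hdb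
  have hA := hdb.ok
  have hm := hdb.m
  have hsym : ∀ e < A.m, ∃ e' < A.m, A.l e' = A.r e ∧ A.r e' = A.l e :=
    fun e he => hdb.exists_reverse he
  have hlt : ∀ e < A.m, A.l e < n := fun e he => by
    obtain ⟨i, hi, ⟨-, h1, -⟩ | ⟨-, h1, -⟩⟩ := hdb.arc he <;> rw [h1] <;> exact Fin.isLt _
  have hχ : ∀ e < A.m, χ (A.l e) ≠ χ (A.r e) := fun e he => by
    have key : ∀ i, ∀ hi : i < es.length, χ es[i].1 ≠ χ es[i].2 := fun i hi => by
      have hadj : G.Adj es[i].1 es[i].2 := by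
        rw [← SimpleGraph.mem_edgeSet, ← hes.2]
        exact List.mem_map.2 ⟨es[i], List.getElem_mem hi, rfl⟩
      have := c.valid hadj
      simp only [hχdef, Fin.isLt, dif_pos, Fin.eta, ne_eq, decide_eq_decide]
      omega
    obtain ⟨i, hi, ⟨-, h1, h2⟩ | ⟨-, h1, h2⟩⟩ := hdb.arc he <;> rw [h1, h2]
    · exact key i hi
    · exact (key i hi).symm
  refine (colour_spec hA hχ hsym hlt (by rw [hr₁ 0 (by decide)]; simp [inputState]) hAdef
    (by rw [ha₁ 12 (by decide)]; funext; simp [inputState])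
    (by rw [ha₁ 15 (by decide)]; funext; simp [inputState])).frame.mono ?_
  rintro σ₂ t₂ ⟨⟨harcs, hcol, ht₂⟩, hr₂, ha₂⟩
  refine (levelBound_spec (n := n)
    (by rw [hr₂ 0 (by decide), hr₁ 0 (by decide)]; simp [inputState])).frame.mono ?_
  rintro σ₃ t₃ ⟨⟨hL, hs, ht₃⟩, hr₃, ha₃⟩
  generalize hLdef : σ₃.reg 4 = L at hL hs
  have h2m : σ₂.reg 3 = A.m := by rw [← harcs]; rfl
  have h2l : σ₂.arr 3 = A.l := by rw [← harcs]; rfl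
  refine (orient_spec (m := A.m) (by rw [hr₃ 3 (by decide), h2m])
    (by rw [ha₃ 7 (by decide), ha₂ 7 (by decide), ha₁ 7 (by decide)]; funext
        simp [inputState])).frame.mono ?_
  rintro σ₄ t₄ ⟨⟨hdd, ht₄⟩, hr₄, ha₄⟩
  have h15 : σ₄.arr 15 = σ₂.arr 15 := by rw [ha₄ 15 (by decide), ha₃ 15 (by decide)]
  have henv : Env A L (σ₄.arr 7) σ₄ := by
    refine ⟨?_, ?_, ?_, ?_, ?_, ?_, rfl⟩
    · rw [hr₄ 3 (by decide), hr₃ 3 (by decide), h2m]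
    · rw [hr₄ 4 (by decide), hLdef]
    · rw [ha₄ 3 (by decide), ha₃ 3 (by decide), h2l]
    · rw [ha₄ 4 (by decide), ha₃ 4 (by decide), ← harcs]; rfl
    · rw [ha₄ 5 (by decide), ha₃ 5 (by decide), ← harcs]; rfl
    · rw [ha₄ 6 (by decide), ha₃ 6 (by decide), ← harcs]; rfl
  have hrep : Represents A n (σ₄.arr 15) (σ₄.arr 7) G := by
    refine hdb.represents hes (by rw [h15]; exact hcol) fun e he => ?_
    rw [hdd e he, ha₃ 15 (by decide), h15, ha₃ 3 (by decide), h2l]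
  have hm0 : 0 < A.m := by omega
  refine (rounds_spec hA hm0 hsym (k := k)
    (by rw [hr₄ 2 (by decide), hr₃ 2 (by decide), hr₂ 2 (by decide), hr₁ 2 (by decide)]
        simp [inputState]) hL henv hrep).frame.mono ?_
  rintro σ₅ t₅ ⟨⟨⟨H, dd, hH, henv₅, hrep₅⟩, ht₅⟩, hr₅, ha₅⟩
  refine (maximumMatching_spec hA hm0 henv₅ fun ml mr hc => ?_).frame.mono ?_
  · -- `n ≤ (L + 1) L`, by the choice of the level bound.
    have := card_matched_le (ml := ml) hlt
    nlinarith
  rintro σ₆ t₆ ⟨⟨henv₆, hopt, ht₆⟩, hr₆, ha₆⟩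
  refine (output_spec (n := n)
    (by rw [hr₆ 0 (by decide), hr₅ 0 (by decide), hr₄ 0 (by decide), hr₃ 0 (by decide),
          hr₂ 0 (by decide), hr₁ 0 (by decide)]
        simp [inputState])
    (by rw [ha₆ 2 (by decide), ha₅ 2 (by decide), ha₄ 2 (by decide), ha₃ 2 (by decide),
          ha₂ 2 (by decide), ha₁ 2 (by decide)]
        funext; simp [inputState])).mono ?_
  rintro τ t₇ ⟨hout, ht₇⟩
  refine ⟨⟨H, hH, ?_⟩, L, hs, ?_⟩
  · have hset : outputSet n τ = (searchCover A n (σ₄.arr 15) (σ₆.arr 12) (σ₆.arr 13))ᶜ := by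
      ext v
      simp only [outputSet, searchCover, Finset.mem_filter, Finset.mem_compl, Finset.mem_univ,
        true_and]
      rw [hout v v.isLt, henv₆.hd, ha₆ 15 (by decide), ha₅ 15 (by decide)]
    obtain ⟨M, hM, hcard, -⟩ := hrep₅.exists_matching hopt.cons
    rw [hset]
    exact KDep.isMaximumIndepSet_compl_of_isVertexCover hM
      (isVertexCover_searchCover hA hsym hrep₅ hopt)
      ((card_searchCover_le hA hsym hopt).trans hcard.ge)
  · rw [hm] at ht₂ ht₄ ht₅ ht₆
    have h1 : es.length * (L + 2) ≤ k * es.length * (L + 2) := by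
      rw [mul_assoc]; exact Nat.le_mul_of_pos_left _ hk
    have h2 : k * (2 * es.length * (L + 2) * 1100) = 2200 * (k * es.length * (L + 2)) := by ring
    have h3 : 2 * es.length * (L + 2) * 1000 = 2000 * (es.length * (L + 2)) := by ring
    have h4 : es.length * 2 ≤ es.length * (L + 2) := Nat.mul_le_mul_left _ (by omega)
    simp only [Test.cost, Expr.cost]
    omega

/-- Without edges, all vertices are output. -/
theorem algorithm_spec_nil {k : ℕ} (hes : IsEdgeList G []) :
    WP algorithm (inputState n k []) fun τ t => KDep.IsAlgorithmOutput G k (outputSet n τ) ∧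
      t ≤ 200 * n + 100 := by
  have hG : G.edgeSet = ∅ := Set.eq_empty_of_forall_notMem fun e he => by
    simpa using (hes.2 e).2 he
  have hadj : ∀ x y, ¬ G.Adj x y := fun x y hxy => by
    have : s(x, y) ∈ G.edgeSet := hxy
    rw [hG] at this
    exact this
  rw [algorithm, WP_ite]
  refine ⟨fun _ => ?_, fun h => absurd (by simp [inputState]) h⟩
  refine (WP_forLoop (by decide) (by decide) (by decide) (c := 14) (n := n)
    (fun i τ φ => (∀ v < i, τ.arr 2 v = 1) ∧ φ = 0) ?_ (by simp [inputState]) (φ := 0)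
    (by simp)).mono ?_
  · rintro i hi τ φ ⟨h, rfl⟩ hj
    simp [hj]
    intro v hv
    rcases hv.lt_or_eq with hv | rfl
    · rw [Function.update_of_ne (by omega)]
      exact h v hv
    · simp
  · rintro τ t ⟨φ, ⟨h, rfl⟩, ht⟩
    refine ⟨⟨fun _ => G, ⟨rfl, fun i _ => ⟨⊥, ⟨fun v hv => hv.elim, fun M _ => ?_⟩, by simp⟩⟩, ?_⟩,
      ?_⟩
    · have : M.edgeSet = ∅ := Set.subset_eq_empty M.edgeSet_subset hG
      simp [this]
    · have : outputSet n τ = Finset.univ :=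
        Finset.filter_true_of_mem fun v _ => h v v.isLt
      rw [this]
      exact ⟨fun x _ y _ _ => hadj x y, fun T _ => Finset.card_le_univ T⟩
    · simp only [Test.cost, Expr.cost]
      omega

/-- The level bound is `O(√n)`. -/
theorem time_bound {s M k t : ℕ} (hn : 1 ≤ n) (hs : s * (s + 1) ≤ 2 * n + 2 * s)
    (ht : t ≤ 200 * n + 100 + 5000 * (k * M * (s + 2))) :
    (t : ℝ) ≤ 25000 * ((k : ℝ) * (M : ℝ) * √(n : ℝ) + n + 1) := by
  have hr : (1 : ℝ) ≤ √(n : ℝ) := Real.one_le_sqrt.2 (by exact_mod_cast hn)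
  have hr2 : √(n : ℝ) * √(n : ℝ) = n := Real.mul_self_sqrt (by positivity)
  have hs' : (s : ℝ) * (s + 1) ≤ 2 * n + 2 * s := by exact_mod_cast hs
  have h1 : (s : ℝ) + 2 ≤ 5 * √(n : ℝ) := by
    by_contra! h
    nlinarith
  have ht' : (t : ℝ) ≤ 200 * n + 100 + 5000 * (k * M * (s + 2)) := by exact_mod_cast ht
  have h2 : (k : ℝ) * M * (s + 2) ≤ k * M * (5 * √(n : ℝ)) := by gcongr
  have : (0 : ℝ) ≤ n := by positivity
  linarith

end RAM

theorem mainTheorem1 :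
    -- bipartite graphs: every output is feasible and within the ratio `1 + k / (k + 2)`
    (∀ {V : Type*} [Finite V] (G : SimpleGraph V) (k : ℕ) (S : Finset V),
      1 ≤ k → G.IsBipartite → KDep.IsAlgorithmOutput G k S →
        KDep.IsKDependent G k S ∧
        ∀ I : Finset V, KDep.IsMaximumKDependent G k I →
          (I.card : ℝ) ≤ (1 + (k : ℝ) / ((k : ℝ) + 2)) * (S.card : ℝ)) ∧
    -- running time: one program carries out the algorithm on all bipartite graphs and all `k`
    (∃ (P : RAM.Program) (C : ℝ), ∀ (n : ℕ) (G : SimpleGraph (Fin n)) (k : ℕ)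
      (es : List (Fin n × Fin n)), 1 ≤ k → G.IsBipartite → RAM.IsEdgeList G es →
        ∃ (τ : RAM.State) (t : ℕ), RAM.Exec P (RAM.inputState n k es) τ t ∧
          KDep.IsAlgorithmOutput G k (RAM.outputSet n τ) ∧
          (t : ℝ) ≤ C * ((k : ℝ) * (es.length : ℝ) * Real.sqrt (n : ℝ) + (n : ℝ) + 1)) ∧
    -- the same ratio whenever matchings are only removed from König–Egerváry graphs
    (∀ {V : Type*} [Finite V] (G : SimpleGraph V) (k : ℕ) (H : ℕ → SimpleGraph V) (S : Finset V),
      1 ≤ k → KDep.IsResidualSequence G k H → (∀ i < k, KDep.IsKonigEgervary (H i)) →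
        (H k).IsMaximumIndepSet S →
        KDep.IsKDependent G k S ∧
        ∀ I : Finset V, KDep.IsMaximumKDependent G k I →
          (I.card : ℝ) ≤ (1 + (k : ℝ) / ((k : ℝ) + 2)) * (S.card : ℝ)) := by
  refine ⟨fun G k S _ hG hS => ?_, ⟨RAM.algorithm, 25000, fun n G k es hk hG hes => ?_⟩,
    fun G k H S _ hH hK hS => hH.isKDependent_and_ratio hK hS⟩
  · obtain ⟨H, hH, hS⟩ := hS
    refine hH.isKDependent_and_ratio (fun i hi => ?_) hS
    have := hH.anti (Nat.zero_le i) hi.le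
    rw [hH.1] at this
    exact KDep.isKonigEgervary_of_isBipartite (hG.mono_left this)
  · rcases es.eq_nil_or_concat with rfl | ⟨es', e, rfl⟩
    · obtain ⟨τ, t, he, hout, ht⟩ := RAM.algorithm_spec_nil (k := k) hes
      refine ⟨τ, t, he, hout, ?_⟩
      have ht' : (t : ℝ) ≤ 200 * n + 100 := by exact_mod_cast ht
      have : (0 : ℝ) ≤ n := by positivity
      simp
      linarith
    · obtain ⟨τ, t, he, hout, s, hs, ht⟩ := RAM.algorithm_spec hk hG hes (by simp)
      exact ⟨τ, t, he, hout, RAM.time_bound e.1.pos hs ht⟩
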